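/- **Setting.** Let $\eta>0$ and let $\mathcal H$ be the Paley–Wiener space of real (continuous) functions $f\in L^2(\mathbb R)$ whose Fourier transform is supported in $[-\eta,\eta]$ (angular frequency), with kernel $k(z,s)=\frac{\sin(\eta(z-s))}{\pi(z-s)}$ for $z\ne s$ and $k(z,z)=\eta/\pi$. Let $1\le d\le n$, $\alpha,\beta\in(0,1)$, $\delta_0>0$, and suppose: * (A0) $(x_1,y_1),\dots,(x_n,y_n)$ are i.i.d. pairs of real random variables with $\mathbb E[y_k^2]<\infty$; * (A2) the inputs $x_k$ are uniformly distributed on $[0,1]$; * (A3) $f_*\in\mathcal H$, $|f_*(x)|\le 1$ for all $x\in[0,1]$, and $\int_{\mathbb R\setminus[0,1]}f_*^2(x)\,dx\le\delta_0$. **The band.** Given random intervals with (possibly infinite) endpoints $\nu_k,\mu_k$, $k=1,\dots,d$, put $$\tau=\frac1d\sum_{k=1}^d\max\{\nu_k^2,\mu_k^2\}+\sqrt{\frac{\ln\alpha}{-2d}}+\delta_0 .$$ For $x_0\in[0,1]\setminus\{x_1,\dots,x_d\}$ let $\widetilde K_0=(k(x_i,x_j))_{i,j=0}^d$, and let $I_1(x_0)$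 and $I_2(x_0)$ be the minimum and the maximum (infimum and supremum in $[-\infty,\infty]$, should they not be attained) of $z_0$ over all $(z_0,\dots,z_d)\in\mathbb R^{d+1}$ with $$(z_0,\dots,z_d)\,\widetilde K_0^{-1}(z_0,\dots,z_d)^{\mathsf T}\le\tau,\qquad \nu_k\le z_k\le\mu_k\quad(k=1,\dots,d);$$ if there is no such vector, $(I_1(x_0),I_2(x_0))=(1,-1)$, an empty interval. At an observed input put $(I_1(x_k),I_2(x_k))=(\nu_k,\mu_k)$. Let $\mathcal I=\{(x,y):x\in[0,1],\ I_1(x)\le y\le I_2(x)\}$. **The KGP/SPS intervals.** Fix $\lambda>0$, weights $w_1,\dots,w_n>0$ with $W=\mathrm{diag}(w_1,\dots,w_n)$, and integers $0<q<m$ with $q/m\le\beta$. Let $K_1=(k(x_i,x_j))_{i\le n,\,j\le d}$, $K_2=(k(x_i,x_j))_{i,j\le d}$, $$\Phi=\begin{bmatrix}\tfrac1{\sqrt n}W^{1/2}K_1\\ \sqrt\lambda\,K_2^{1/2}\end{bmatrix},\qquad v=\begin{bmatrix}\tfrac1{\sqrt n}W^{1/2}y\\ 0\end{bmatrix},\qquad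 R=\tfrac1n\Phi^{\mathsf T}\Phi,\qquad \hat\theta=(\Phi^{\mathsf T}\Phi)^{-1}\Phi^{\mathsf T}v .$$ Draw i.i.d. uniform random signs $\sigma_{i,k}$ ($1\le i<m$, $1\le k\le d$) and a uniform random permutation $\pi$ of $\{0,\dots,m-1\}$ for breaking ties, independent of each other and of the sample; put $\sigma_{0,k}=1$. Let $Z_i(\theta)=\big\|R^{-1/2}\tfrac1n\Phi^{\mathsf T}D_i(v-\Phi\theta)\big\|^2$, where $D_i$ is the diagonal matrix that multiplies the first $d$ residuals by $\sigma_{i,1},\dots,\sigma_{i,d}$ and leaves all the others unchanged. Let $\Theta$ be the set of $\theta\in\mathbb R^d$ for which $Z_0(\theta)$ has rank at most $m-q$ in the increasing order of $Z_0(\theta),\dots,Z_{m-1}(\theta)$ (ties ordered by $\pi$). Let $r\in[0,\infty]$ be the $q$-th largest of the numbers $\sup\{Z_0(\theta):Z_0(\theta)\le Z_i(\theta)\}$, $1\le i<m$, and let $\widehat\Theta=\{\theta:(\theta-\hat\theta)^{\mathsf T}R(\theta-\hat\theta)\le r\}$. If $\Theta\neq\emptyset$, then $\nu_k$ and $\mu_k$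 are the infimum and the supremum of $\sum_{i=1}^d k(x_i,x_k)\theta_i$ over $\theta\in\widehat\Theta$; if $\Theta=\emptyset$, then $\nu_k=1$ and $\mu_k=-1$ for all $k$. **Theorem.** Assume (A0), (A2), (A3). 1. For any random intervals with $\mathbb P\big(\forall k\in\{1,\dots,d\}:\ \nu_k\le f_*(x_k)\le\mu_k\big)\ge1-\beta$, the band satisfies $$\mathbb P\big(\{(x,f_*(x)):x\in[0,1]\}\subseteq\mathcal I\big)\ \ge\ 1-\alpha-\beta .$$ 2. Assume also (A1): each noise $\varepsilon_k=y_k-f_*(x_k)$ is distributed symmetrically about zero given its input, i.e. $(x_k,\varepsilon_k)$ and $(x_k,-\varepsilon_k)$ have the same law. Then the KGP/SPS intervals satisfy $\mathbb P\big(\forall k\in\{1,\dots,d\}:\ \nu_k\le f_*(x_k)\le\mu_k\big)\ge1-\beta$, and the band built from them satisfies $$\mathbb P\big(\{(x,f_*(x)):x\in[0,1]\}\subseteq\mathcal I\big)\ \ge\ 1-\alpha-\beta .$$ -/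

import Mathlib

open MeasureTheory ProbabilityTheory
open scoped FourierTransform Matrix

noncomputable section

namespace PWBand

/-! ### Paley-Wiener spaces -/

/-- The Paley-Wiener space of real functions in `L²(ℝ)` whose Fourier transform is supported in
`[-η, η]` (in angular frequency `2πξ`; Mathlib's transform uses the kernel `exp (-2πi t ξ)`).
As in a reproducing kernel Hilbert space, its elements are genuine functions: each `L²` class is
represented by its continuous member. -/
def paleyWiener (η : ℝ) : Set (ℝ → ℝ) :=
  {f | Continuous f ∧ ∃ h : MemLp (fun t => (f t : ℂ)) 2 (volume : Measure ℝ),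
    ∀ᵐ ξ : ℝ, η < |2 * Real.pi * ξ| → (𝓕 (h.toLp (fun t => (f t : ℂ))) : Lp ℂ 2 volume) ξ = 0}

/-- The Paley-Wiener kernel. -/
def pwKernel (η z s : ℝ) : ℝ :=
  if z = s then η / Real.pi else Real.sin (η * (z - s)) / (Real.pi * (z - s))

/-! ### Assumptions -/

/-- An inner-measure form of `p ≤ P(S)`, which needs no measurability of the event `S` and
is the usual inequality if `S` is measurable. -/
def HoldsWithProb {Ω : Type*} [MeasurableSpace Ω] (P : Measure Ω) (p : ℝ) (S : Set Ω) : Prop :=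
  ∃ E : Set Ω, MeasurableSet E ∧ E ⊆ S ∧ ENNReal.ofReal p ≤ P E

/-- The pairs `(X k, Y k)` are i.i.d. with square-integrable outputs. -/
structure IIDSample {Ω : Type*} [MeasurableSpace Ω] (P : Measure Ω) {n : ℕ}
    (X Y : Fin n → Ω → ℝ) : Prop where
  measurable_input : ∀ k, Measurable (X k)
  measurable_output : ∀ k, Measurable (Y k)
  indep : iIndepFun (fun k ω => (X k ω, Y k ω)) P
  identDistrib : ∀ i j, IdentDistrib (fun ω => (X i ω, Y i ω)) (fun ω => (X j ω, Y j ω)) P P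
  sq_integrable : ∀ k, Integrable (fun ω => Y k ω ^ 2) P

/-- Each noise `ε k = Y k - f (X k)` is symmetric about zero given its input:
`(X k, ε k)` and `(X k, - ε k)` have the same law. -/
def SymmetricNoise {Ω : Type*} [MeasurableSpace Ω] (P : Measure Ω) {n : ℕ} (f : ℝ → ℝ)
    (X Y : Fin n → Ω → ℝ) : Prop :=
  ∀ k, IdentDistrib (fun ω => (X k ω, Y k ω - f (X k ω))) (fun ω => (X k ω, -(Y k ω - f (X k ω))))
    P P

/-- The inputs are uniformly distributed on `[0, 1]`. -/
def UniformInputs {Ω : Type*} [MeasurableSpace Ω] (P : Measure Ω) {n : ℕ}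
    (X : Fin n → Ω → ℝ) : Prop :=
  ∀ k, P.map (X k) = (volume : Measure ℝ).restrict (Set.Icc 0 1)

/-- `f` is band-limited, bounded by one on `[0, 1]` and almost time-limited to `[0, 1]`. -/
structure RegularTarget (η δ₀ : ℝ) (f : ℝ → ℝ) : Prop where
  mem : f ∈ paleyWiener η
  bounded : ∀ x ∈ Set.Icc (0 : ℝ) 1, |f x| ≤ 1
  tail : ∫ x in (Set.Icc (0 : ℝ) 1)ᶜ, f x ^ 2 ≤ δ₀

/-! ### The confidence band from simultaneous intervals at observed inputs -/

section Band

variable {d : ℕ}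

/-- The bound `τ` on the squared norm (infinite if one of the intervals is unbounded). -/
def normBound (α δ₀ : ℝ) (ν μ : Fin d → EReal) : EReal :=
  ((1 / (d : ℝ) : ℝ) : EReal) * ∑ k, max (ν k ^ 2) (μ k ^ 2)
    + ((Real.sqrt (Real.log α / (-2 * (d : ℝ))) + δ₀ : ℝ) : EReal)

/-- The Gram matrix of the points `x₀, x₁, …, x_d`. -/
def extendedGram (η : ℝ) (x : Fin d → ℝ) (x₀ : ℝ) : Matrix (Fin (d + 1)) (Fin (d + 1)) ℝ :=
  Matrix.of fun i j =>
    pwKernel η ((Fin.cons x₀ x : Fin (d + 1) → ℝ) i) ((Fin.cons x₀ x : Fin (d + 1) → ℝ) j)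

/-- The feasible set of the two optimization problems: vectors `(z₀, …, z_d)` that satisfy the
quadratic Gram constraint and the box constraints. -/
def feasible (η α δ₀ : ℝ) (x : Fin d → ℝ) (ν μ : Fin d → EReal) (x₀ : ℝ) :
    Set (Fin (d + 1) → ℝ) :=
  {z | ((z ⬝ᵥ ((extendedGram η x x₀)⁻¹ *ᵥ z) : ℝ) : EReal) ≤ normBound α δ₀ ν μ ∧
    ∀ k : Fin d, ν k ≤ (z k.succ : EReal) ∧ (z k.succ : EReal) ≤ μ k}

open scoped Classical in
/-- The pair `(I₁ x₀, I₂ x₀)`: the optimal values of the minimization and of the maximization of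
`z₀` over the feasible set, and `(1, -1)` (an empty interval) if the problems are infeasible.
At an observed input `x₀ = x k` the given interval `[ν k, μ k]` is returned. -/
def bandEndpoints (η α δ₀ : ℝ) (x : Fin d → ℝ) (ν μ : Fin d → EReal) (x₀ : ℝ) : EReal × EReal :=
  if h : ∃ k, x₀ = x k then (ν h.choose, μ h.choose)
  else if (feasible η α δ₀ x ν μ x₀).Nonempty then
    (sInf ((fun z => ((z 0 : ℝ) : EReal)) '' feasible η α δ₀ x ν μ x₀),
      sSup ((fun z => ((z 0 : ℝ) : EReal)) '' feasible η α δ₀ x ν μ x₀))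
  else (1, -1)

/-- The confidence region over `[0, 1]` described by the band. -/
def bandRegion (η α δ₀ : ℝ) (x : Fin d → ℝ) (ν μ : Fin d → EReal) : Set (ℝ × ℝ) :=
  {p | p.1 ∈ Set.Icc (0 : ℝ) 1 ∧ (bandEndpoints η α δ₀ x ν μ p.1).1 ≤ (p.2 : EReal) ∧
    (p.2 : EReal) ≤ (bandEndpoints η α δ₀ x ν μ p.1).2}

/-- The graph of `f` over `[0, 1]`. -/
def graphOnUnit (f : ℝ → ℝ) : Set (ℝ × ℝ) :=
  {p | p.1 ∈ Set.Icc (0 : ℝ) 1 ∧ p.2 = f p.1}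

end Band

/-! ### The kernel gradient perturbation (sign-perturbed sums) intervals -/

/-- The random numbers used by the method with `M` perturbations: a sign matrix and a
permutation of `{0, …, M}` for breaking ties. -/
def Seed (M d : ℕ) : Type := (Fin M → Fin d → ℤˣ) × Equiv.Perm (Fin (M + 1))

instance (M d : ℕ) : MeasurableSpace (Seed M d) := ⊤

section KGP

variable {n d : ℕ}

/-- `K₁`: the first `d` columns of the Gram matrix of `x₁, …, x_n`. -/
def gramCols (η : ℝ) (hd : d ≤ n) (x : Fin n → ℝ) : Matrix (Fin n) (Fin d) ℝ :=
  Matrix.of fun i j => pwKernel η (x i) (x (Fin.castLE hd j))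

/-- `K₂`: the Gram matrix of `x₁, …, x_d`. -/
def gramBlock (η : ℝ) (hd : d ≤ n) (x : Fin n → ℝ) : Matrix (Fin d) (Fin d) ℝ :=
  Matrix.of fun i j => pwKernel η (x (Fin.castLE hd i)) (x (Fin.castLE hd j))

/-- The regressor matrix `Φ` of the least squares form `‖v - Φ θ‖²` of kernel ridge regression;
`cfc Real.sqrt` is the principal square root of a positive semidefinite matrix. -/
def regressor (η lam : ℝ) (w : Fin n → ℝ) (hd : d ≤ n) (x : Fin n → ℝ) :
    Matrix (Fin n ⊕ Fin d) (Fin d) ℝ :=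
  Matrix.fromRows
    ((1 / Real.sqrt n) • (Matrix.diagonal (fun k => Real.sqrt (w k)) * gramCols η hd x))
    (Real.sqrt lam • cfc Real.sqrt (gramBlock η hd x))

/-- The output vector `v` of the least squares form. -/
def response (w y : Fin n → ℝ) : Fin n ⊕ Fin d → ℝ :=
  Sum.elim (fun k => (1 / Real.sqrt n) * (Real.sqrt (w k) * y k)) (fun _ => 0)

/-- The normalized matrix `(1/n) Φᵀ Φ`. -/
def shape (η lam : ℝ) (w : Fin n → ℝ) (hd : d ≤ n) (x : Fin n → ℝ) : Matrix (Fin d) (Fin d) ℝ :=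
  (1 / (n : ℝ)) • ((regressor η lam w hd x)ᵀ * regressor η lam w hd x)

/-- The least squares estimate `(Φᵀ Φ)⁻¹ Φᵀ v`. -/
def lsEstimate (η lam : ℝ) (w : Fin n → ℝ) (hd : d ≤ n) (x y : Fin n → ℝ) : Fin d → ℝ :=
  ((regressor η lam w hd x)ᵀ * regressor η lam w hd x)⁻¹ *ᵥ
    ((regressor η lam w hd x)ᵀ *ᵥ response w y)

/-- The sign multipliers of the residuals: only the first `d` residuals are perturbed. -/
def signMultiplier (s : Fin d → ℤˣ) : Fin n ⊕ Fin d → ℝ :=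
  Sum.elim (fun k => if h : (k : ℕ) < d then (((s ⟨k, h⟩ : ℤˣ) : ℤ) : ℝ) else 1) (fun _ => 1)

/-- The sign-perturbed sum `(1/n) Φᵀ D_s (v - Φ θ)`. -/
def perturbedSum (η lam : ℝ) (w : Fin n → ℝ) (hd : d ≤ n) (x y : Fin n → ℝ)
    (s : Fin d → ℤˣ) (θ : Fin d → ℝ) : Fin d → ℝ :=
  (1 / (n : ℝ)) • ((regressor η lam w hd x)ᵀ *ᵥ
    (signMultiplier s * (response w y - regressor η lam w hd x *ᵥ θ)))

/-- The squared norm of the perturbed sum shaped by `((1/n) Φᵀ Φ) ^ (-1/2)`. -/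
def perturbedNorm (η lam : ℝ) (w : Fin n → ℝ) (hd : d ≤ n) (x y : Fin n → ℝ)
    (s : Fin d → ℤˣ) (θ : Fin d → ℝ) : ℝ :=
  perturbedSum η lam w hd x y s θ ⬝ᵥ
    ((shape η lam w hd x)⁻¹ *ᵥ perturbedSum η lam w hd x y s θ)

/-- The (exact) confidence region: those `θ` for which the unperturbed quantity has rank at most
`m - q` in the increasing order of all `m = M + 1` quantities, ties being broken by the
permutation. The rank is one plus the number of perturbed quantities that are below. -/
def kgpRegion (η lam : ℝ) (w : Fin n → ℝ) (hd : d ≤ n) (x y : Fin n → ℝ) {M : ℕ} (q : ℕ)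
    (a : Seed M d) : Set (Fin d → ℝ) :=
  {θ | 1 + Set.ncard {i : Fin M |
      perturbedNorm η lam w hd x y (a.1 i) θ < perturbedNorm η lam w hd x y 1 θ ∨
      (perturbedNorm η lam w hd x y (a.1 i) θ = perturbedNorm η lam w hd x y 1 θ ∧
        a.2 i.succ < a.2 0)} ≤ M + 1 - q}

/-- The optimal value of: maximize the unperturbed quantity subject to its being at most the
perturbed one. -/
def maxUnperturbed (η lam : ℝ) (w : Fin n → ℝ) (hd : d ≤ n) (x y : Fin n → ℝ)
    (s : Fin d → ℤˣ) : EReal :=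
  sSup ((fun θ => (perturbedNorm η lam w hd x y 1 θ : EReal)) ''
    {θ | perturbedNorm η lam w hd x y 1 θ ≤ perturbedNorm η lam w hd x y s θ})

/-- The radius of the ellipsoid: the `q`-th largest of the `M` optimal values. -/
def kgpRadius (η lam : ℝ) (w : Fin n → ℝ) (hd : d ≤ n) (x y : Fin n → ℝ) {M : ℕ} (q : ℕ)
    (a : Seed M d) : EReal :=
  sSup {t | q ≤ Set.ncard {i : Fin M | t ≤ maxUnperturbed η lam w hd x y (a.1 i)}}

/-- The ellipsoidal outer approximation of the confidence region. -/
def kgpEllipsoid (η lam : ℝ) (w : Fin n → ℝ) (hd : d ≤ n) (x y : Fin n → ℝ) {M : ℕ} (q : ℕ)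
    (a : Seed M d) : Set (Fin d → ℝ) :=
  {θ | (((θ - lsEstimate η lam w hd x y) ⬝ᵥ
      (shape η lam w hd x *ᵥ (θ - lsEstimate η lam w hd x y)) : ℝ) : EReal)
        ≤ kgpRadius η lam w hd x y q a}

/-- The values of `φ_kᵀ θ` over the ellipsoid, where `φ_k = (k(x₁, x_k), …, k(x_d, x_k))`. -/
def kgpValues (η lam : ℝ) (w : Fin n → ℝ) (hd : d ≤ n) (x y : Fin n → ℝ) {M : ℕ} (q : ℕ)
    (a : Seed M d) (k : Fin d) : Set EReal :=
  (fun θ : Fin d → ℝ => (((fun i => gramBlock η hd x i k) ⬝ᵥ θ : ℝ) : EReal)) ''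
    kgpEllipsoid η lam w hd x y q a

open scoped Classical in
/-- The lower endpoint `ν_k`; it is `1` if the confidence region is empty. -/
def kgpLower (η lam : ℝ) (w : Fin n → ℝ) (hd : d ≤ n) (x y : Fin n → ℝ) {M : ℕ} (q : ℕ)
    (a : Seed M d) (k : Fin d) : EReal :=
  if (kgpRegion η lam w hd x y q a).Nonempty then sInf (kgpValues η lam w hd x y q a k) else 1

open scoped Classical in
/-- The upper endpoint `μ_k`; it is `-1` if the confidence region is empty. -/
def kgpUpper (η lam : ℝ) (w : Fin n → ℝ) (hd : d ≤ n) (x y : Fin n → ℝ) {M : ℕ} (q : ℕ)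
    (a : Seed M d) (k : Fin d) : EReal :=
  if (kgpRegion η lam w hd x y q a).Nonempty then sSup (kgpValues η lam w hd x y q a k) else -1

end KGP

/-- The seed has independent uniform signs and an independent uniform permutation, that is,
it is uniform on the finite set of seeds, and it is independent of the sample. -/
structure RandomSeed {Ω : Type*} [MeasurableSpace Ω] (P : Measure Ω) {n M d : ℕ}
    (X Y : Fin n → Ω → ℝ) (A : Ω → Seed M d) : Prop where
  measurable : Measurable A
  uniform : P.map A = uniformOn Set.univ
  indep : IndepFun (fun ω (k : Fin n) => (X k ω, Y k ω)) A P

end PWBand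

end

/-!
The band contains the graph of `f` as soon as two events occur: the intervals cover `f` at the first
`d` inputs, and the empirical second moment of `f` at these inputs is not much smaller than
`∫ x in [0, 1], f x ^ 2`. By Hoeffding's inequality the second event fails with probability at most
`α` (`empirical_norm_bound`). On both events `τ` bounds `∫ f ^ 2`. In the frequency domain
evaluation at `x` is the inner product with the exponential `bandExp η x` truncated to the band, and
the kernel is the Gram kernel of these exponentials (`inner_bandExp_bandExp`, `exists_spectrum`).
Hence the Gram quadratic form of the vector of values of `f` is the squared norm of the minimum norm
interpolant, which is at most `∫ f ^ 2` (`interpolation_quadratic_le`), and that vector is feasible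
for the optimization problems that define the band.

For the kernel gradient perturbation intervals, let `θ` be the coefficient vector that interpolates
`f` at the first `d` inputs. It exists almost surely: the inputs are almost surely distinct, and
exponentials at distinct points are linearly independent on the band (`kernelGram_posDef`). At this
`θ` the first `d` residuals are the scaled noises, so flipping noises, which preserves the law of
the sample, multiplies the perturbing signs by a fixed sign vector (`perturbedNorm_flipOutput`).
Averaging over the flips makes all rows of the sign matrix exchangeable, so that with random tie
breaking the unperturbed quantity has one of the `q` largest ranks with probability at most
`q / (M + 1)` (`sum_measure_cons_one_le`). Otherwise `θ` is in the exact confidence region, hence in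
the ellipsoid, whose quadratic form is the unperturbed quantity (`perturbedNorm_one`), and the
intervals cover (`kgp_covers`). The quantities compared involve the square root of the Gram matrix
only through its square, which makes them measurable functions of the sample.
-/

noncomputable section

namespace PWBand

/-! ### Band-limited exponentials and the Paley-Wiener kernel -/

/-- The frequency band `[-η / 2π, η / 2π]` of the Paley-Wiener space, in ordinary frequency. -/
def freqBand (η : ℝ) : Set ℝ := Set.Icc (-(η / (2 * Real.pi))) (η / (2 * Real.pi))

/-- The exponential `ξ ↦ exp (-2πi x ξ)` cut off to the frequency band. In the frequency domain it
represents evaluation at `x`. -/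
def bandExpFun (η x : ℝ) : ℝ → ℂ :=
  (freqBand η).indicator fun ξ => Complex.exp ((-(2 * Real.pi * x * ξ) : ℝ) * Complex.I)

lemma measurableSet_freqBand (η : ℝ) : MeasurableSet (freqBand η) := measurableSet_Icc

lemma memLp_bandExpFun (η x : ℝ) : MemLp (bandExpFun η x) 2 (volume : Measure ℝ) := by
  rw [bandExpFun, memLp_indicator_iff_restrict (measurableSet_freqBand η)]
  have : IsFiniteMeasure ((volume : Measure ℝ).restrict (freqBand η)) := by
    rw [freqBand]; infer_instance
  refine MemLp.of_bound (C := 1) ?_ ?_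
  · exact Continuous.aestronglyMeasurable (by fun_prop)
  · exact Filter.Eventually.of_forall fun ξ => (Complex.norm_exp_ofReal_mul_I _).le

/-- The truncated exponential as an element of `L²`. -/
def bandExp (η x : ℝ) : Lp ℂ 2 (volume : Measure ℝ) := (memLp_bandExpFun η x).toLp _

lemma inner_bandExp_left (η x : ℝ) (F : Lp ℂ 2 (volume : Measure ℝ)) :
    inner ℂ (bandExp η x) F =
      ∫ ξ in freqBand η, Complex.exp ((2 * Real.pi * x * ξ : ℝ) * Complex.I) * F ξ := by
  rw [L2.inner_def, ← integral_indicator (measurableSet_freqBand η)]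
  refine integral_congr_ae ?_
  filter_upwards [(memLp_bandExpFun η x).coeFn_toLp] with ξ hξ
  rw [bandExp, hξ, bandExpFun]
  by_cases h : ξ ∈ freqBand η
  · simp only [Set.indicator_of_mem h, RCLike.inner_apply, ← Complex.exp_conj]
    rw [mul_comm]
    congr 2
    rw [map_mul, Complex.conj_I, Complex.conj_ofReal]
    push_cast
    ring
  · simp [Set.indicator_of_notMem h]

/-- The Paley-Wiener kernel is the Gram kernel of the truncated exponentials. -/
lemma inner_bandExp_bandExp {η : ℝ} (hη : 0 < η) (x y : ℝ) :
    inner ℂ (bandExp η x) (bandExp η y) = (pwKernel η x y : ℂ) := by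
  have hpi := Real.pi_pos
  rw [inner_bandExp_left]
  have h1 : ∫ ξ in freqBand η, Complex.exp ((2 * Real.pi * x * ξ : ℝ) * Complex.I) *
        (bandExp η y : ℝ → ℂ) ξ =
      ∫ ξ in freqBand η, Complex.exp ((2 * Real.pi * (x - y) * Complex.I) * ξ) := by
    refine setIntegral_congr_ae (measurableSet_freqBand η) ?_
    filter_upwards [(memLp_bandExpFun η y).coeFn_toLp] with ξ hξ h
    rw [bandExp, hξ, bandExpFun]
    simp only [Set.indicator_of_mem h, ← Complex.exp_add]
    congr 1
    push_cast
    ring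
  have hle : -(η / (2 * Real.pi)) ≤ η / (2 * Real.pi) := by
    have : 0 < η / (2 * Real.pi) := by positivity
    linarith
  rw [h1, freqBand, integral_Icc_eq_integral_Ioc, ← intervalIntegral.integral_of_le hle, pwKernel]
  split_ifs with hxy
  · subst hxy
    simp
    field_simp
    ring
  · have hne : ((x : ℂ) - y) ≠ 0 := by
      rw [sub_ne_zero]; exact_mod_cast hxy
    have hpic : (Real.pi : ℂ) ≠ 0 := by exact_mod_cast hpi.ne'
    have hc : (2 * Real.pi * (x - y) * Complex.I : ℂ) ≠ 0 := by
      simp [hne, hpic]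
    rw [integral_exp_mul_complex hc]
    push_cast
    rw [Complex.sin]
    have e1 : (2 * Real.pi * (x - y) * Complex.I : ℂ) * (η / (2 * Real.pi)) =
      η * (x - y) * Complex.I := by field_simp
    have e2 : (2 * Real.pi * (x - y) * Complex.I : ℂ) * (-(η / (2 * Real.pi))) =
      -(η * (x - y)) * Complex.I := by field_simp
    rw [e1, e2]
    rw [div_eq_div_iff hc (by simp [hne, hpic])]
    ring_nf
    rw [Complex.I_sq]
    ring

/-- The Gram matrix of the Paley-Wiener kernel at a family of points. -/
def kernelGram {ι : Type*} (η : ℝ) (x : ι → ℝ) : Matrix ι ι ℝ :=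
  Matrix.of fun i j => pwKernel η (x i) (x j)

lemma pwKernel_comm (η x y : ℝ) : pwKernel η x y = pwKernel η y x := by
  unfold pwKernel
  by_cases h : x = y
  · simp [h]
  · rw [if_neg h, if_neg (Ne.symm h), ← neg_sub y x, mul_neg, mul_neg,
      Real.sin_neg, neg_div_neg_eq]

lemma kernelGram_isHermitian {ι : Type*} (η : ℝ) (x : ι → ℝ) : (kernelGram η x).IsHermitian := by
  ext i j
  simp [kernelGram, pwKernel_comm η (x i)]

section Gram

variable {ι : Type*} [Fintype ι]

lemma kernelGram_quadratic {η : ℝ} (hη : 0 < η) (x c : ι → ℝ) :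
    c ⬝ᵥ (kernelGram η x *ᵥ c) = ‖∑ i, (c i : ℂ) • bandExp η (x i)‖ ^ 2 := by
  have h := inner_self_eq_norm_sq_to_K (𝕜 := ℂ) (∑ i, (c i : ℂ) • bandExp η (x i))
  rw [sum_inner] at h
  simp only [inner_sum, inner_smul_left, inner_smul_right, inner_bandExp_bandExp hη,
    Complex.conj_ofReal] at h
  have h2 : ((∑ i, ∑ j, c i * (c j * pwKernel η (x i) (x j)) : ℝ) : ℂ) =
      ((‖∑ i, (c i : ℂ) • bandExp η (x i)‖ ^ 2 : ℝ) : ℂ) := by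
    push_cast
    refine Eq.trans ?_ h
    exact Finset.sum_congr rfl fun i _ => Finset.sum_congr rfl fun j _ => by ring
  rw [← Complex.ofReal_injective h2]
  simp only [dotProduct, Matrix.mulVec, kernelGram, Matrix.of_apply, Finset.mul_sum]
  exact Finset.sum_congr rfl fun i _ => Finset.sum_congr rfl fun j _ => by ring

lemma kernelGram_posSemidef {η : ℝ} (hη : 0 < η) (x : ι → ℝ) : (kernelGram η x).PosSemidef := by
  refine Matrix.PosSemidef.of_dotProduct_mulVec_nonneg (kernelGram_isHermitian η x) fun c => ?_
  rw [star_trivial, kernelGram_quadratic hη]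
  positivity

/-- Exponentials at distinct points are linearly independent on the band: a vanishing combination
extends from the band to the whole line by analyticity, where it is a combination of distinct
characters of `ℝ`. -/
lemma eq_zero_of_sum_smul_bandExp_eq_zero {η : ℝ} (hη : 0 < η) {x : ι → ℝ}
    (hx : Function.Injective x) {c : ι → ℝ} (hc : ∑ i, (c i : ℂ) • bandExp η (x i) = 0) :
    c = 0 := by
  have hpi := Real.pi_pos
  set g : ℝ → ℂ := fun ξ => ∑ i, (c i : ℂ) *
    Complex.exp ((-(2 * Real.pi * x i * ξ) : ℝ) * Complex.I) with hg
  have hgc : Continuous g := by fun_prop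
  have hga : AnalyticOnNhd ℝ g Set.univ := by
    intro ξ _
    apply Finset.analyticAt_fun_sum
    intro i _
    refine analyticAt_const.mul ?_
    refine (AnalyticAt.restrictScalars (𝕜 := ℝ) (𝕜' := ℂ) analyticAt_cexp).comp ?_
    refine AnalyticAt.mul ?_ analyticAt_const
    refine (Complex.ofRealCLM.analyticAt _).comp ?_
    exact (analyticAt_const.mul analyticAt_id).neg
  have hcomb : ∀ s : Finset ι, (∑ i ∈ s, (c i : ℂ) • bandExp η (x i) : Lp ℂ 2 volume) =ᵐ[volume]
      fun ξ => ∑ i ∈ s, (c i : ℂ) * bandExpFun η (x i) ξ := by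
    classical
    intro s
    induction s using Finset.induction_on with
    | empty =>
      simp only [Finset.sum_empty]
      exact Lp.coeFn_zero _ _ _
    | insert a s ha ih =>
      rw [Finset.sum_insert ha]
      filter_upwards [Lp.coeFn_add ((c a : ℂ) • bandExp η (x a))
        (∑ i ∈ s, (c i : ℂ) • bandExp η (x i)), ih, Lp.coeFn_smul (c a : ℂ) (bandExp η (x a)),
        (memLp_bandExpFun η (x a)).coeFn_toLp] with ξ h1 h2 h3 h4
      rw [h1, Pi.add_apply, h2, h3, Pi.smul_apply, bandExp, h4, Finset.sum_insert ha, smul_eq_mul]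
  have hzero : ∀ᵐ ξ ∂(volume.restrict (Set.Ioo (-(η / (2 * Real.pi))) (η / (2 * Real.pi)))),
      g ξ = (fun _ => (0 : ℂ)) ξ := by
    rw [ae_restrict_iff' measurableSet_Ioo]
    have h0 : (∑ i, (c i : ℂ) • bandExp η (x i) : Lp ℂ 2 volume) =ᵐ[volume] (0 : ℝ → ℂ) := by
      rw [hc]; exact Lp.coeFn_zero _ _ _
    filter_upwards [hcomb Finset.univ, h0] with ξ h1 h2 h3
    rw [h2] at h1
    simp only [bandExpFun, freqBand, Set.indicator_of_mem (Set.Ioo_subset_Icc_self h3)] at h1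
    exact h1.symm
  have hpos : 0 < η / (2 * Real.pi) := by positivity
  have heq := Measure.eqOn_open_of_ae_eq hzero isOpen_Ioo hgc.continuousOn continuousOn_const
  have hall : g = fun _ => 0 := by
    refine hga.eq_of_eventuallyEq (z₀ := 0) (fun _ _ => analyticAt_const) ?_
    exact Filter.eventuallyEq_of_mem (Ioo_mem_nhds (by linarith) hpos) heq
  let χ : ι → (Multiplicative ℝ →* ℂ) := fun i =>
    { toFun := fun ξ =>
        Complex.exp ((-(2 * Real.pi * x i * Multiplicative.toAdd ξ) : ℝ) * Complex.I)
      map_one' := by simp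
      map_mul' := fun a b => by
        rw [← Complex.exp_add, toAdd_mul]
        congr 1
        push_cast
        ring }
  have hχ : Function.Injective χ := by
    intro i j hij
    by_contra hne
    -- at this frequency the two characters differ by the factor `exp (-πi) = -1`
    have hxne : x i - x j ≠ 0 := sub_ne_zero.2 fun h => hne (hx h)
    have h1 := DFunLike.congr_fun hij (Multiplicative.ofAdd (1 / (2 * (x i - x j))))
    have h2 : Complex.exp ((-(2 * Real.pi * x i * (1 / (2 * (x i - x j)))) : ℝ) * Complex.I) =
      Complex.exp ((-(2 * Real.pi * x j * (1 / (2 * (x i - x j)))) : ℝ) * Complex.I) := h1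
    have h3 : Complex.exp (((-(2 * Real.pi * x i * (1 / (2 * (x i - x j)))) : ℝ) * Complex.I) -
      ((-(2 * Real.pi * x j * (1 / (2 * (x i - x j)))) : ℝ) * Complex.I)) = 1 := by
      rw [Complex.exp_sub, h2, div_self (Complex.exp_ne_zero _)]
    have h4 : (((-(2 * Real.pi * x i * (1 / (2 * (x i - x j)))) : ℝ) * Complex.I) -
      ((-(2 * Real.pi * x j * (1 / (2 * (x i - x j)))) : ℝ) * Complex.I)) =
        -(Real.pi * Complex.I) := by
      have h5 : -(2 * Real.pi * x i * (1 / (2 * (x i - x j)))) -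
          -(2 * Real.pi * x j * (1 / (2 * (x i - x j)))) = -Real.pi := by
        field_simp
        ring
      rw [← sub_mul, ← Complex.ofReal_sub, h5, Complex.ofReal_neg, neg_mul]
    rw [h4, Complex.exp_neg, Complex.exp_pi_mul_I] at h3
    norm_num at h3
  have hli := (linearIndependent_monoidHom (Multiplicative ℝ) ℂ).comp χ hχ
  rw [Fintype.linearIndependent_iff] at hli
  have hfin := hli (fun i => (c i : ℂ)) (by
    funext ξ
    have := congrFun hall (Multiplicative.toAdd ξ)
    simp only [hg] at this
    simpa [χ, Finset.sum_apply] using this)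
  funext i
  exact_mod_cast hfin i

lemma kernelGram_posDef {η : ℝ} (hη : 0 < η) {x : ι → ℝ} (hx : Function.Injective x) :
    (kernelGram η x).PosDef := by
  refine Matrix.PosDef.of_dotProduct_mulVec_pos (kernelGram_isHermitian η x) fun c hc => ?_
  rw [star_trivial, kernelGram_quadratic hη]
  have : ∑ i, (c i : ℂ) • bandExp η (x i) ≠ 0 := fun h =>
    hc (eq_zero_of_sum_smul_bandExp_eq_zero hη hx h)
  positivity

end Gram

/-! ### The reproducing property and minimum norm interpolation -/

/-- For an integrable `L²` function, the `L²` inverse Fourier transform is given by the Fourier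
integral. Both sides are tested against Schwartz functions. -/
lemma fourierInv_ae_eq_integral (F : Lp ℂ 2 (volume : Measure ℝ))
    (hF : Integrable (F : ℝ → ℂ) volume) :
    ∀ᵐ t : ℝ, (𝓕⁻ F : Lp ℂ 2 volume) t = 𝓕⁻ (F : ℝ → ℂ) t := by
  have hcont : Continuous (𝓕⁻ (F : ℝ → ℂ)) := by
    rw [Real.fourierInv_eq_fourier_comp_neg]
    exact VectorFourier.fourierIntegral_continuous Real.continuous_fourierChar
      continuous_inner hF.comp_neg
  refine ae_eq_of_integral_contDiff_smul_eq ((Lp.memLp _).locallyIntegrable (by norm_num))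
    hcont.locallyIntegrable fun g g_smooth g_cpt => ?_
  have hg₁ : HasCompactSupport (Complex.ofRealCLM ∘ g) := g_cpt.comp_left rfl
  have hg₂ : ContDiff ℝ (⊤ : ℕ∞) (Complex.ofRealCLM ∘ g) := by fun_prop
  set φ := hg₁.toSchwartzMap hg₂ with hφ
  have h1 : ∫ t, g t • (𝓕⁻ F : Lp ℂ 2 volume) t =
      Lp.toTemperedDistribution (𝓕⁻ F : Lp ℂ 2 volume) φ := by
    rw [Lp.toTemperedDistribution_apply]
    exact integral_congr_ae (Filter.Eventually.of_forall fun t => by simp [hφ])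
  rw [h1, ← Lp.fourierInv_toTemperedDistribution_eq, TemperedDistribution.fourierInv_apply,
    Lp.toTemperedDistribution_apply]
  have h2 : ∀ t, g t • 𝓕⁻ (F : ℝ → ℂ) t = φ t • 𝓕⁻ (F : ℝ → ℂ) t := fun t => by simp [hφ]
  simp_rw [h2, SchwartzMap.fourierInv_coe]
  -- Fubini, for the inverse transform: the pairing is taken with the opposite sign
  have h3 := VectorFourier.integral_fourierIntegral_smul_eq_flip (μ := (volume : Measure ℝ))
    (ν := (volume : Measure ℝ)) (L := -(innerₗ ℝ)) (f := (φ : ℝ → ℂ)) (g := (F : ℝ → ℂ))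
    Real.continuous_fourierChar
    ((continuous_inner (𝕜 := ℝ) (E := ℝ)).neg) φ.integrable hF
  refine Eq.trans ?_ (h3.trans ?_)
  · congr 1 with ξ
  · congr 1 with ξ
    congr 1
    rw [Real.fourierInv_eq, VectorFourier.fourierIntegral]
    simp [mul_comm]

/-- The reproducing property: a Paley-Wiener function has a spectrum of the same `L²` norm, against
which the truncated exponentials evaluate the function. -/
lemma exists_spectrum {η : ℝ} {f : ℝ → ℝ} (hf : f ∈ paleyWiener η) :
    ∃ F : Lp ℂ 2 (volume : Measure ℝ), ‖F‖ ^ 2 = ∫ t, f t ^ 2 ∧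
      ∀ x, inner ℂ (bandExp η x) F = (f x : ℂ) := by
  obtain ⟨hc, h, hsupp⟩ := hf
  have hpi := Real.pi_pos
  set u : Lp ℂ 2 (volume : Measure ℝ) := h.toLp _ with hu
  set F : Lp ℂ 2 (volume : Measure ℝ) := 𝓕 u with hFdef
  have hout : ∀ᵐ ξ : ℝ, ξ ∉ freqBand η → F ξ = 0 := by
    filter_upwards [hsupp] with ξ h1 h2
    apply h1
    rw [freqBand, Set.mem_Icc, ← abs_le, not_le, div_lt_iff₀ (by positivity)] at h2
    rw [abs_mul, abs_of_pos (by positivity : (0 : ℝ) < 2 * Real.pi)]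
    linarith
  -- an `L²` function supported in a bounded band is integrable
  have hFint : Integrable (F : ℝ → ℂ) volume := by
    have h1 : IntegrableOn (F : ℝ → ℂ) (freqBand η) volume :=
      ((Lp.memLp F).locallyIntegrable (by norm_num)).integrableOn_isCompact isCompact_Icc
    rw [← integrable_indicator_iff (measurableSet_freqBand η)] at h1
    refine h1.congr ?_
    filter_upwards [hout] with ξ hξ
    by_cases hmem : ξ ∈ freqBand η
    · exact Set.indicator_of_mem hmem _
    · rw [hξ hmem]
      exact Set.indicator_of_notMem hmem _
  refine ⟨F, ?_, fun x => ?_⟩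
  · rw [hFdef, Lp.norm_fourier_eq]
    have h1 := inner_self_eq_norm_sq_to_K (𝕜 := ℂ) u
    rw [L2.inner_def] at h1
    have h2 : ∫ t, inner ℂ (u t) (u t) = ((∫ t, f t ^ 2 : ℝ) : ℂ) := by
      rw [← integral_complex_ofReal]
      refine integral_congr_ae ?_
      filter_upwards [h.coeFn_toLp] with t ht
      rw [hu, ht]
      simp [sq, ← Complex.ofReal_mul]
    rw [h2] at h1
    have h3 : ((∫ t, f t ^ 2 : ℝ) : ℂ) = ((‖u‖ ^ 2 : ℝ) : ℂ) := by
      rw [h1]; push_cast; rfl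
    exact (Complex.ofReal_injective h3).symm
  · have hinv : (𝓕⁻ F : Lp ℂ 2 volume) = u := by
      rw [hFdef]
      exact FourierTransform.fourierInv_fourier_eq u
    have hcont : Continuous (𝓕⁻ (F : ℝ → ℂ)) := by
      rw [Real.fourierInv_eq_fourier_comp_neg]
      exact VectorFourier.fourierIntegral_continuous Real.continuous_fourierChar
        continuous_inner hFint.comp_neg
    have hae : (fun t => (f t : ℂ)) =ᵐ[volume] 𝓕⁻ (F : ℝ → ℂ) := by
      have h1 := fourierInv_ae_eq_integral F hFint
      rw [hinv] at h1
      filter_upwards [h1, h.coeFn_toLp] with t h2 h3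
      rw [← h2, hu, h3]
    -- both sides are continuous, so the identity holds everywhere
    have heq := Continuous.ae_eq_iff_eq volume (by fun_prop) hcont |>.1 hae
    have hx : (f x : ℂ) = 𝓕⁻ (F : ℝ → ℂ) x := congrFun heq x
    rw [hx, inner_bandExp_left, Real.fourierInv_eq',
      ← integral_indicator (measurableSet_freqBand η)]
    refine integral_congr_ae ?_
    filter_upwards [hout] with ξ hξ
    by_cases hmem : ξ ∈ freqBand η
    · simp only [Set.indicator_of_mem hmem]
      rw [smul_eq_mul]
      congr 3
      simp
      ring
    · have h0 := hξ hmem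
      simp [Set.indicator_of_notMem hmem, h0]

/-- The interpolant of minimum norm has at most the norm of `f`. If the Gram matrix is singular, its
`Matrix` inverse is zero and so is the left-hand side. -/
lemma interpolation_quadratic_le {ι : Type*} [Fintype ι] [DecidableEq ι] {η : ℝ} (hη : 0 < η)
    {f : ℝ → ℝ} (hf : f ∈ paleyWiener η) (x : ι → ℝ) :
    (fun i => f (x i)) ⬝ᵥ ((kernelGram η x)⁻¹ *ᵥ fun i => f (x i)) ≤ ∫ t, f t ^ 2 := by
  obtain ⟨F, hF, hrep⟩ := exists_spectrum hf
  rw [← hF]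
  by_cases hdet : IsUnit (kernelGram η x).det
  swap
  · rw [Matrix.nonsing_inv_apply_not_isUnit _ hdet, Matrix.zero_mulVec, dotProduct_zero]
    positivity
  set z : ι → ℝ := fun i => f (x i) with hz
  set c := (kernelGram η x)⁻¹ *ᵥ z with hc
  have hKc : kernelGram η x *ᵥ c = z := by
    rw [hc, Matrix.mulVec_mulVec, Matrix.mul_nonsing_inv _ hdet, Matrix.one_mulVec]
  set v := ∑ i, (c i : ℂ) • bandExp η (x i) with hv
  have h1 : z ⬝ᵥ c = ‖v‖ ^ 2 := by
    rw [hv, ← kernelGram_quadratic hη, hKc, dotProduct_comm]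
  have h2 : inner ℂ v F = ((z ⬝ᵥ c : ℝ) : ℂ) := by
    rw [hv, sum_inner]
    simp only [inner_smul_left, hrep, Complex.conj_ofReal, dotProduct, hz]
    push_cast
    exact Finset.sum_congr rfl fun i _ => mul_comm _ _
  have h3 : z ⬝ᵥ c ≤ ‖v‖ * ‖F‖ := by
    have := norm_inner_le_norm (𝕜 := ℂ) v F
    rw [h2, Complex.norm_real] at this
    exact (le_abs_self _).trans this
  rw [h1] at h3 ⊢
  rcases (norm_nonneg v).eq_or_lt with h0 | h0
  · rw [← h0]; simp
  · have : ‖v‖ ≤ ‖F‖ := by nlinarith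
    gcongr

/-! ### The empirical norm bound and the band -/

lemma sq_le_max_sq {r : ℝ} {a b : EReal} (ha : a ≤ r) (hb : (r : EReal) ≤ b) :
    ((r ^ 2 : ℝ) : EReal) ≤ max (a ^ 2) (b ^ 2) := by
  rcases le_total 0 r with h | h
  · refine le_max_of_le_right ?_
    induction b with
    | bot => simp at hb
    | top => simp [sq]
    | coe b =>
      rw [EReal.coe_le_coe_iff] at hb
      rw [← EReal.coe_pow, EReal.coe_le_coe_iff]
      gcongr
  · refine le_max_of_le_left ?_
    induction a with
    | top => simp at ha
    | bot => simp [sq]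
    | coe a =>
      rw [EReal.coe_le_coe_iff] at ha
      rw [← EReal.coe_pow, EReal.coe_le_coe_iff]
      nlinarith

lemma integrable_sq_of_mem_paleyWiener {η : ℝ} {f : ℝ → ℝ} (hf : f ∈ paleyWiener η) :
    Integrable (fun t => f t ^ 2) := by
  obtain ⟨-, h, -⟩ := hf
  have := h.integrable_norm_pow (by norm_num)
  simpa using this

/-- If the intervals cover and the empirical second moment of `f` is not much smaller than its
mean, then `τ` bounds the squared norm of `f`. -/
lemma integral_sq_le_normBound {η α δ₀ : ℝ} {f : ℝ → ℝ} (hf : RegularTarget η δ₀ f) {d : ℕ}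
    {x : Fin d → ℝ} {ν μ : Fin d → EReal}
    (hcov : ∀ k, ν k ≤ (f (x k) : EReal) ∧ (f (x k) : EReal) ≤ μ k)
    (hemp : ∫ t in Set.Icc (0 : ℝ) 1, f t ^ 2 ≤
      1 / (d : ℝ) * ∑ k, f (x k) ^ 2 + Real.sqrt (Real.log α / (-2 * (d : ℝ)))) :
    ((∫ t, f t ^ 2 : ℝ) : EReal) ≤ normBound α δ₀ ν μ := by
  have hsplit := integral_add_compl (measurableSet_Icc (a := (0 : ℝ)) (b := 1))
    (integrable_sq_of_mem_paleyWiener hf.mem)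
  have htail := hf.tail
  have h1 : ∫ t, f t ^ 2 ≤ 1 / (d : ℝ) * ∑ k, f (x k) ^ 2 +
      (Real.sqrt (Real.log α / (-2 * (d : ℝ))) + δ₀) := by linarith
  refine (EReal.coe_le_coe_iff.2 h1).trans ?_
  have hsum : ((∑ k, f (x k) ^ 2 : ℝ) : EReal) = ∑ k, ((f (x k) ^ 2 : ℝ) : EReal) :=
    map_sum (⟨⟨Real.toEReal, EReal.coe_zero⟩, EReal.coe_add⟩ : ℝ →+ EReal) _ _
  rw [EReal.coe_add, EReal.coe_mul, hsum, normBound]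
  refine add_le_add (mul_le_mul_of_nonneg_left ?_ ?_) le_rfl
  · exact Finset.sum_le_sum fun k _ => sq_le_max_sq (hcov k).1 (hcov k).2
  · rw [EReal.coe_nonneg]; positivity

lemma graphOnUnit_subset_bandRegion {η α δ₀ : ℝ} (hη : 0 < η) {f : ℝ → ℝ}
    (hf : RegularTarget η δ₀ f) {d : ℕ} {x : Fin d → ℝ} {ν μ : Fin d → EReal}
    (hcov : ∀ k, ν k ≤ (f (x k) : EReal) ∧ (f (x k) : EReal) ≤ μ k)
    (hemp : ∫ t in Set.Icc (0 : ℝ) 1, f t ^ 2 ≤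
      1 / (d : ℝ) * ∑ k, f (x k) ^ 2 + Real.sqrt (Real.log α / (-2 * (d : ℝ)))) :
    graphOnUnit f ⊆ bandRegion η α δ₀ x ν μ := by
  rintro ⟨x₀, y₀⟩ ⟨hx₀, hy₀⟩
  obtain rfl : y₀ = f x₀ := hy₀
  refine ⟨hx₀, ?_⟩
  dsimp only
  unfold bandEndpoints
  split_ifs with h1 h2
  · have h := h1.choose_spec
    have h3 := hcov h1.choose
    rw [← h] at h3
    exact h3
  all_goals
    have hfeas : (fun i => f ((Fin.cons x₀ x : Fin (d + 1) → ℝ) i)) ∈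
        feasible η α δ₀ x ν μ x₀ := by
      refine ⟨le_trans ?_ (integral_sq_le_normBound hf hcov hemp), fun k => by simpa using hcov k⟩
      rw [EReal.coe_le_coe_iff]
      exact interpolation_quadratic_le hη hf.mem _
  · exact ⟨sInf_le ⟨_, hfeas, by simp⟩, le_sSup ⟨_, hfeas, by simp⟩⟩
  · exact absurd ⟨_, hfeas⟩ h2

lemma UniformInputs.ae_mem_Icc {Ω : Type*} [MeasurableSpace Ω] {P : Measure Ω} {n : ℕ}
    {X : Fin n → Ω → ℝ} (hX : UniformInputs P X)
    (hm : ∀ k, Measurable (X k)) (k : Fin n) : ∀ᵐ ω ∂P, X k ω ∈ Set.Icc (0 : ℝ) 1 := by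
  refine ae_of_ae_map (hm k).aemeasurable ?_
  rw [hX k]
  exact ae_restrict_mem measurableSet_Icc

section Probability

variable {Ω : Type*} [MeasurableSpace Ω] {P : Measure Ω} [IsProbabilityMeasure P]

/-- Hoeffding's inequality for the empirical second moment of `f` at the first `d` inputs. -/
lemma empirical_norm_bound {η α δ₀ : ℝ} (hα : α ∈ Set.Ioo (0 : ℝ) 1) {f : ℝ → ℝ}
    (hf : RegularTarget η δ₀ f) {n d : ℕ} (hd1 : 1 ≤ d) (hd : d ≤ n) {X Y : Fin n → Ω → ℝ}
    (hS : IIDSample P X Y) (hX : UniformInputs P X) :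
    HoldsWithProb P (1 - α) {ω | ∫ t in Set.Icc (0 : ℝ) 1, f t ^ 2 ≤
      1 / (d : ℝ) * ∑ k : Fin d, f (X (Fin.castLE hd k) ω) ^ 2 +
        Real.sqrt (Real.log α / (-2 * (d : ℝ)))} := by
  have hfm : Measurable f := hf.mem.1.measurable
  have hd0 : (0 : ℝ) < d := by exact_mod_cast hd1
  -- the lower tail of the empirical mean of `f ^ 2` is the upper tail of that of `-f ^ 2`
  set V : Fin d → Ω → ℝ := fun k ω => -(f (X (Fin.castLE hd k) ω) ^ 2) with hV
  have hVm : ∀ k, Measurable (V k) := fun k =>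
    ((hfm.comp (hS.measurable_input _)).pow_const 2).neg
  have hVE : ∀ k, P[V k] = -∫ t in Set.Icc (0 : ℝ) 1, f t ^ 2 := by
    intro k
    rw [← hX (Fin.castLE hd k), integral_map (hS.measurable_input _).aemeasurable
      (hfm.pow_const 2).aestronglyMeasurable, ← integral_neg]
  have hsub : ∀ k ∈ Finset.univ, HasSubgaussianMGF (fun ω => V k ω - P[V k])
      ((‖(0 : ℝ) - (-1)‖₊ / 2) ^ 2) P := by
    intro k _
    refine hasSubgaussianMGF_of_mem_Icc (hVm k).aemeasurable ?_
    filter_upwards [hX.ae_mem_Icc hS.measurable_input (Fin.castLE hd k)] with ω hω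
    have := hf.bounded _ hω
    have h1 : f (X (Fin.castLE hd k) ω) ^ 2 ≤ 1 := (sq_le_one_iff_abs_le_one _).2 this
    exact ⟨by simp only [hV]; linarith, by simp only [hV]; nlinarith⟩
  have hind : iIndepFun (fun k ω => V k ω - P[V k]) P := by
    have h1 := hS.indep.precomp (Fin.castLE_injective hd)
    exact h1.comp (fun k p => -(f p.1 ^ 2) - P[V k]) fun k => by fun_prop
  set s : ℝ := Real.sqrt (Real.log α / (-2 * (d : ℝ))) with hs
  have hlog : Real.log α < 0 := Real.log_neg hα.1 hα.2
  have hs2 : s ^ 2 = Real.log α / (-2 * (d : ℝ)) :=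
    Real.sq_sqrt (div_nonneg_of_nonpos hlog.le (by linarith))
  have hH := HasSubgaussianMGF.measure_sum_ge_le_of_iIndepFun hind hsub
    (ε := d * s) (by positivity)
  -- the variables range in an interval of length one, and `s` is chosen to make the bound `α`
  have hexp : Real.exp (-(d * s) ^ 2 / (2 * ∑ _k : Fin d,
      (((‖(0 : ℝ) - (-1)‖₊ / 2) ^ 2 : NNReal) : ℝ))) = α := by
    rw [← Real.exp_log hα.1]
    congr 1
    rw [mul_pow, hs2]
    simp
    field_simp
  push_cast at hH hexp
  rw [hexp] at hH
  have hmeas : MeasurableSet {ω | d * s ≤ ∑ k, (V k ω - P[V k])} :=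
    measurableSet_le measurable_const (Finset.measurable_fun_sum _ fun k _ => (hVm k).sub_const _)
  refine ⟨{ω | d * s ≤ ∑ k, (V k ω - P[V k])}ᶜ, hmeas.compl, fun ω hω => ?_, ?_⟩
  · simp only [Set.mem_compl_iff, Set.mem_ofPred_eq, not_le, hVE, Finset.sum_sub_distrib,
      Finset.sum_const, Finset.card_univ, Fintype.card_fin, nsmul_eq_mul] at hω
    simp only [hV, Finset.sum_neg_distrib] at hω
    rw [Set.mem_ofPred_eq, one_div, inv_mul_eq_div, ← sub_le_iff_le_add, le_div_iff₀ hd0]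
    linarith
  · rw [← ofReal_measureReal, measureReal_compl hmeas, probReal_univ]
    exact ENNReal.ofReal_le_ofReal (by linarith)

/-- The union bound for events of high probability. -/
lemma HoldsWithProb.inter {a b : ℝ} {S T U : Set Ω} (hS : HoldsWithProb P (1 - a) S)
    (hT : HoldsWithProb P (1 - b) T) (hU : S ∩ T ⊆ U) : HoldsWithProb P (1 - a - b) U := by
  obtain ⟨E, hE, hES, hEP⟩ := hS
  obtain ⟨F, hF, hFT, hFP⟩ := hT
  refine ⟨E ∩ F, hE.inter hF, (Set.inter_subset_inter hES hFT).trans hU, ?_⟩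
  rw [← ofReal_measureReal, ENNReal.ofReal_le_ofReal_iff measureReal_nonneg] at hEP hFP ⊢
  have h1 := measureReal_union_add_inter (μ := P) (s := E) hF
  have h2 : P.real (E ∪ F) ≤ 1 := measureReal_le_one
  linarith

/-- Simultaneous confidence intervals at the first `d` inputs extend to a confidence band. -/
lemma holdsWithProb_graph_subset_band {η α β δ₀ : ℝ} (hη : 0 < η) (hα : α ∈ Set.Ioo (0 : ℝ) 1)
    {f : ℝ → ℝ} (hf : RegularTarget η δ₀ f) {n d : ℕ} (hd1 : 1 ≤ d) (hd : d ≤ n)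
    {X Y : Fin n → Ω → ℝ} (hS : IIDSample P X Y) (hX : UniformInputs P X)
    (ν μ : Ω → Fin d → EReal)
    (hcov : HoldsWithProb P (1 - β) {ω | ∀ k : Fin d,
      ν ω k ≤ (f (X (Fin.castLE hd k) ω) : EReal) ∧
      (f (X (Fin.castLE hd k) ω) : EReal) ≤ μ ω k}) :
    HoldsWithProb P (1 - α - β) {ω | graphOnUnit f ⊆
      bandRegion η α δ₀ (fun k => X (Fin.castLE hd k) ω) (ν ω) (μ ω)} :=
  (empirical_norm_bound hα hf hd1 hd hS hX).inter hcov fun _ h =>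
    graphOnUnit_subset_bandRegion hη hf h.2 h.1

end Probability

/-! ### The least squares form without the matrix square root -/

section Algebra

variable {n d : ℕ}

lemma gramBlock_posSemidef {η : ℝ} (hη : 0 < η) (hd : d ≤ n) (x : Fin n → ℝ) :
    (gramBlock η hd x).PosSemidef := kernelGram_posSemidef hη fun k => x (Fin.castLE hd k)

lemma gramBlock_posDef {η : ℝ} (hη : 0 < η) (hd : d ≤ n) {x : Fin n → ℝ}
    (hx : Function.Injective fun k => x (Fin.castLE hd k)) : (gramBlock η hd x).PosDef :=
  kernelGram_posDef hη hx

lemma cfc_sqrt_mul_self_of_posSemidef {m : Type*} [Fintype m] [DecidableEq m]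
    {K : Matrix m m ℝ} (hK : K.PosSemidef) : cfc Real.sqrt K * cfc Real.sqrt K = K := by
  have hsa : IsSelfAdjoint K := hK.isHermitian
  rw [← cfc_mul Real.sqrt Real.sqrt K]
  conv_rhs => rw [← cfc_id ℝ K]
  refine cfc_congr fun t ht => ?_
  rw [hK.isHermitian.spectrum_real_eq_range_eigenvalues] at ht
  obtain ⟨i, rfl⟩ := ht
  exact Real.mul_self_sqrt (hK.eigenvalues_nonneg i)

lemma transpose_cfc_sqrt {m : Type*} [Fintype m] [DecidableEq m] (K : Matrix m m ℝ) :
    (cfc Real.sqrt K)ᵀ = cfc Real.sqrt K := by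
  have h : IsSelfAdjoint (cfc Real.sqrt K) := cfc_predicate _ _
  rw [← Matrix.conjTranspose_eq_transpose_of_trivial]
  exact h

/-- The upper block `n ^ (-1/2) W ^ (1/2) K₁` of the regressor matrix. -/
def dataBlock (η : ℝ) (w : Fin n → ℝ) (hd : d ≤ n) (x : Fin n → ℝ) : Matrix (Fin n) (Fin d) ℝ :=
  (1 / Real.sqrt n) • (Matrix.diagonal (fun k => Real.sqrt (w k)) * gramCols η hd x)

lemma regressor_eq_fromRows (η lam : ℝ) (w : Fin n → ℝ) (hd : d ≤ n) (x : Fin n → ℝ) :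
    regressor η lam w hd x = Matrix.fromRows (dataBlock η w hd x)
      (Real.sqrt lam • cfc Real.sqrt (gramBlock η hd x)) := rfl

lemma gram_regressor {η lam : ℝ} (hη : 0 < η) (hlam : 0 < lam) (w : Fin n → ℝ) (hd : d ≤ n)
    (x : Fin n → ℝ) :
    (regressor η lam w hd x)ᵀ * regressor η lam w hd x =
      (dataBlock η w hd x)ᵀ * dataBlock η w hd x + lam • gramBlock η hd x := by
  rw [regressor_eq_fromRows, Matrix.transpose_fromRows, Matrix.fromCols_mul_fromRows,
    Matrix.transpose_smul, transpose_cfc_sqrt, Matrix.smul_mul, Matrix.mul_smul, smul_smul,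
    Real.mul_self_sqrt hlam.le,
    cfc_sqrt_mul_self_of_posSemidef (gramBlock_posSemidef hη hd x)]

lemma regressor_mulVec (η lam : ℝ) (w : Fin n → ℝ) (hd : d ≤ n) (x : Fin n → ℝ)
    (θ : Fin d → ℝ) :
    regressor η lam w hd x *ᵥ θ = Sum.elim (dataBlock η w hd x *ᵥ θ)
      (Real.sqrt lam • (cfc Real.sqrt (gramBlock η hd x) *ᵥ θ)) := by
  rw [regressor_eq_fromRows, Matrix.fromRows_mulVec, Matrix.smul_mulVec]

/-- The residuals of the data block after the sign perturbation. -/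
def signedResidual (η : ℝ) (w : Fin n → ℝ) (hd : d ≤ n) (x y : Fin n → ℝ) (s : Fin d → ℤˣ)
    (θ : Fin d → ℝ) : Fin n → ℝ := fun k =>
  (if h : (k : ℕ) < d then (((s ⟨k, h⟩ : ℤˣ) : ℤ) : ℝ) else 1) *
    ((1 / Real.sqrt n) * (Real.sqrt (w k) * y k) - (dataBlock η w hd x *ᵥ θ) k)

lemma perturbedSum_eq {η lam : ℝ} (hη : 0 < η) (hlam : 0 < lam) (w : Fin n → ℝ) (hd : d ≤ n)
    (x y : Fin n → ℝ) (s : Fin d → ℤˣ) (θ : Fin d → ℝ) :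
    perturbedSum η lam w hd x y s θ = (1 / (n : ℝ)) •
      ((dataBlock η w hd x)ᵀ *ᵥ signedResidual η w hd x y s θ -
        lam • (gramBlock η hd x *ᵥ θ)) := by
  have h1 : signMultiplier s * (response w y - regressor η lam w hd x *ᵥ θ) =
      Sum.elim (signedResidual η w hd x y s θ)
        (-(Real.sqrt lam • (cfc Real.sqrt (gramBlock η hd x) *ᵥ θ))) := by
    rw [regressor_mulVec]
    ext (k | k)
    · simp [signMultiplier, response, signedResidual]
    · simp [signMultiplier, response]
  rw [perturbedSum, h1, regressor_eq_fromRows, Matrix.transpose_fromRows,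
    Matrix.fromCols_mulVec_sumElim, Matrix.transpose_smul, transpose_cfc_sqrt, Matrix.mulVec_neg,
    Matrix.smul_mulVec,
    Matrix.mulVec_smul, smul_smul, Real.mul_self_sqrt hlam.le, Matrix.mulVec_mulVec,
    cfc_sqrt_mul_self_of_posSemidef (gramBlock_posSemidef hη hd x), sub_eq_add_neg]

/-! ### The confidence region, its ellipsoidal approximation and the intervals -/

lemma shape_posDef {η lam : ℝ} (hη : 0 < η) (hlam : 0 < lam) (w : Fin n → ℝ) (hd1 : 1 ≤ d)
    (hd : d ≤ n) {x : Fin n → ℝ} (hx : Function.Injective fun k => x (Fin.castLE hd k)) :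
    (shape η lam w hd x).PosDef := by
  have hn : (0 : ℝ) < 1 / n := by
    have : 0 < n := by omega
    positivity
  rw [shape, gram_regressor hη hlam]
  refine Matrix.PosDef.smul (Matrix.PosDef.posSemidef_add ?_ ?_) hn
  · rw [← Matrix.conjTranspose_eq_transpose_of_trivial]
    exact Matrix.posSemidef_conjTranspose_mul_self _
  · exact (gramBlock_posDef hη hd hx).smul hlam

/-- The unperturbed quantity is the ellipsoid's quadratic form. -/
lemma perturbedNorm_one {η lam : ℝ} (hη : 0 < η) (hlam : 0 < lam) (w : Fin n → ℝ) (hd1 : 1 ≤ d)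
    (hd : d ≤ n) {x : Fin n → ℝ} (hx : Function.Injective fun k => x (Fin.castLE hd k))
    (y : Fin n → ℝ) (θ : Fin d → ℝ) :
    perturbedNorm η lam w hd x y 1 θ = (θ - lsEstimate η lam w hd x y) ⬝ᵥ
      (shape η lam w hd x *ᵥ (θ - lsEstimate η lam w hd x y)) := by
  have hR := shape_posDef hη hlam w hd1 hd hx
  have hRu : IsUnit (shape η lam w hd x).det := hR.det_pos.ne'.isUnit
  have hn : (n : ℝ) ≠ 0 := by
    have : 0 < n := by omega
    positivity
  set Φ := regressor η lam w hd x with hΦ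
  have hG : Φᵀ * Φ = (n : ℝ) • shape η lam w hd x := by
    rw [shape, smul_smul, mul_one_div_cancel hn, one_smul]
  have hGu : IsUnit (Φᵀ * Φ).det := by
    rw [hG, Matrix.det_smul]
    exact ((isUnit_iff_ne_zero.2 hn).pow _).mul hRu
  have hls : (Φᵀ * Φ) *ᵥ lsEstimate η lam w hd x y = Φᵀ *ᵥ response w y := by
    rw [lsEstimate, Matrix.mulVec_mulVec, Matrix.mul_nonsing_inv _ hGu, Matrix.one_mulVec]
  have hone : (signMultiplier 1 : Fin n ⊕ Fin d → ℝ) = 1 := by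
    ext (k | k) <;> simp [signMultiplier]
  have hsum : perturbedSum η lam w hd x y 1 θ =
      -(shape η lam w hd x *ᵥ (θ - lsEstimate η lam w hd x y)) := by
    rw [perturbedSum, hone, one_mul, ← hΦ, Matrix.mulVec_sub, ← hls, Matrix.mulVec_mulVec,
      ← Matrix.mulVec_sub, shape, Matrix.smul_mulVec, ← smul_neg, ← Matrix.mulVec_neg, neg_sub]
  rw [perturbedNorm, hsum, Matrix.mulVec_neg, Matrix.mulVec_mulVec,
    Matrix.nonsing_inv_mul _ hRu, Matrix.one_mulVec, neg_dotProduct_neg, dotProduct_comm]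

lemma kgpRegion_subset_kgpEllipsoid {η lam : ℝ} (hη : 0 < η) (hlam : 0 < lam) (w : Fin n → ℝ)
    (hd1 : 1 ≤ d) (hd : d ≤ n) {x : Fin n → ℝ}
    (hx : Function.Injective fun k => x (Fin.castLE hd k)) (y : Fin n → ℝ) {M q : ℕ}
    (hq : q ≤ M) (a : Seed M d) :
    kgpRegion η lam w hd x y q a ⊆ kgpEllipsoid η lam w hd x y q a := by
  intro θ hθ
  rw [kgpEllipsoid, Set.mem_ofPred_eq, ← perturbedNorm_one hη hlam w hd1 hd hx, kgpRadius]
  -- by the rank condition at least `q` indices do not precede, and each bounds `Z₀(θ)` by its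
  -- optimal value
  refine le_sSup ?_
  rw [kgpRegion, Set.mem_ofPred_eq] at hθ
  rw [Set.mem_ofPred_eq]
  set B := {i : Fin M | perturbedNorm η lam w hd x y (a.1 i) θ < perturbedNorm η lam w hd x y 1 θ ∨
      (perturbedNorm η lam w hd x y (a.1 i) θ = perturbedNorm η lam w hd x y 1 θ ∧
        a.2 i.succ < a.2 0)} with hB
  have hcompl : Bᶜ.ncard = M - B.ncard := by
    rw [Set.ncard_compl, Nat.card_eq_fintype_card, Fintype.card_fin]
  refine le_trans (b := Bᶜ.ncard) (by omega) (Set.ncard_le_ncard ?_ (Set.toFinite _))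
  intro i hi
  have hle : perturbedNorm η lam w hd x y 1 θ ≤ perturbedNorm η lam w hd x y (a.1 i) θ := by
    by_contra hlt
    exact hi (Or.inl (not_le.1 hlt))
  rw [Set.mem_ofPred_eq, maxUnperturbed]
  exact le_sSup ⟨θ, hle, rfl⟩

/-- The coefficient vector that interpolates `f` at the first `d` inputs. -/
def interpolant (η : ℝ) (f : ℝ → ℝ) (hd : d ≤ n) (x : Fin n → ℝ) : Fin d → ℝ :=
  (gramBlock η hd x)⁻¹ *ᵥ fun k => f (x (Fin.castLE hd k))

lemma gramBlock_mulVec_interpolant {η : ℝ} (hη : 0 < η) (f : ℝ → ℝ) (hd : d ≤ n) {x : Fin n → ℝ}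
    (hx : Function.Injective fun k => x (Fin.castLE hd k)) :
    gramBlock η hd x *ᵥ interpolant η f hd x = fun k => f (x (Fin.castLE hd k)) := by
  have hu : IsUnit (gramBlock η hd x).det := (gramBlock_posDef hη hd hx).det_pos.ne'.isUnit
  rw [interpolant, Matrix.mulVec_mulVec, Matrix.mul_nonsing_inv _ hu, Matrix.one_mulVec]

/-- If the interpolant belongs to the confidence region, the intervals cover. -/
lemma kgp_covers {η lam : ℝ} (hη : 0 < η) (hlam : 0 < lam) (w : Fin n → ℝ)
    (hd1 : 1 ≤ d) (hd : d ≤ n) {x : Fin n → ℝ}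
    (hx : Function.Injective fun k => x (Fin.castLE hd k)) (y : Fin n → ℝ) {M q : ℕ}
    (hq : q ≤ M) (a : Seed M d) (f : ℝ → ℝ)
    (hmem : interpolant η f hd x ∈ kgpRegion η lam w hd x y q a) (k : Fin d) :
    kgpLower η lam w hd x y q a k ≤ (f (x (Fin.castLE hd k)) : EReal) ∧
      (f (x (Fin.castLE hd k)) : EReal) ≤ kgpUpper η lam w hd x y q a k := by
  have hne : (kgpRegion η lam w hd x y q a).Nonempty := ⟨_, hmem⟩
  rw [kgpLower, kgpUpper, if_pos hne, if_pos hne]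
  have hval : (f (x (Fin.castLE hd k)) : EReal) ∈ kgpValues η lam w hd x y q a k := by
    refine ⟨_, kgpRegion_subset_kgpEllipsoid hη hlam w hd1 hd hx y hq a hmem, ?_⟩
    have h1 := congrFun (gramBlock_mulVec_interpolant hη f hd hx) k
    rw [← h1]
    dsimp only
    congr 2
    funext i
    exact pwKernel_comm _ _ _
  exact ⟨sInf_le hval, le_sSup hval⟩

/-! ### Flipping the signs of the noises -/

/-- Reflect the outputs at the first `d` inputs about the target, where the sign is `-1`. -/
def flipOutput (f : ℝ → ℝ) (t : Fin d → ℤˣ) (x y : Fin n → ℝ) : Fin n → ℝ := fun k =>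
  f (x k) + (if h : (k : ℕ) < d then (((t ⟨k, h⟩ : ℤˣ) : ℤ) : ℝ) else 1) * (y k - f (x k))

/-- At the interpolant the first `d` residuals are the scaled noises, so that flipping the noises
amounts to multiplying the perturbing signs. -/
lemma perturbedNorm_flipOutput {η lam : ℝ} (hη : 0 < η) (hlam : 0 < lam) (w : Fin n → ℝ)
    (hd : d ≤ n) {x : Fin n → ℝ} (hx : Function.Injective fun k => x (Fin.castLE hd k))
    (y : Fin n → ℝ) (f : ℝ → ℝ) (s t : Fin d → ℤˣ) :
    perturbedNorm η lam w hd x (flipOutput f t x y) s (interpolant η f hd x) =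
      perturbedNorm η lam w hd x y (s * t) (interpolant η f hd x) := by
  have hres : signedResidual η w hd x (flipOutput f t x y) s (interpolant η f hd x) =
      signedResidual η w hd x y (s * t) (interpolant η f hd x) := by
    funext k
    by_cases hk : (k : ℕ) < d
    · have hK : (gramCols η hd x *ᵥ interpolant η f hd x) k = f (x k) :=
        congrFun (gramBlock_mulVec_interpolant hη f hd hx) ⟨k, hk⟩
      simp only [signedResidual, flipOutput, dif_pos hk, dataBlock, Matrix.smul_mulVec,
        ← Matrix.mulVec_mulVec, Matrix.mulVec_diagonal, Pi.smul_apply, smul_eq_mul, hK,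
        Pi.mul_apply, Units.val_mul, Int.cast_mul]
      ring
    · simp [signedResidual, flipOutput, dif_neg hk]
  have hsum : perturbedSum η lam w hd x (flipOutput f t x y) s (interpolant η f hd x) =
      perturbedSum η lam w hd x y (s * t) (interpolant η f hd x) := by
    rw [perturbedSum_eq hη hlam, perturbedSum_eq hη hlam, hres]
  rw [perturbedNorm, perturbedNorm, hsum]

/-! ### Measurability -/

lemma measurable_matrix_inv_apply {α m : Type*} [MeasurableSpace α] [Fintype m] [DecidableEq m]
    {A : α → Matrix m m ℝ} (hA : ∀ i j, Measurable fun p => A p i j) (i j : m) :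
    Measurable fun p => (A p)⁻¹ i j := by
  have hA' : Measurable fun p => (fun i j => A p i j : m → m → ℝ) :=
    measurable_pi_lambda _ fun i => measurable_pi_lambda _ fun j => hA i j
  have hdc : Continuous fun B : m → m → ℝ => (Matrix.of B).det :=
    Continuous.matrix_det continuous_id
  have hac : Continuous fun B : m → m → ℝ => (Matrix.of B).adjugate i j :=
    (Continuous.matrix_adjugate continuous_id).matrix_elem i j
  have hdet : Measurable fun p => (A p).det := hdc.measurable.comp hA'
  have hadj : Measurable fun p => (A p).adjugate i j := hac.measurable.comp hA'
  have : (fun p => (A p)⁻¹ i j) = fun p => (A p).det⁻¹ * (A p).adjugate i j := by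
    funext p
    rw [Matrix.inv_def, Ring.inverse_eq_inv']
    rfl
  rw [this]
  exact hdet.inv.mul hadj

lemma measurable_mulVec_apply {α l m : Type*} [MeasurableSpace α] [Fintype m]
    {A : α → Matrix l m ℝ} {u : α → m → ℝ} (hA : ∀ i j, Measurable fun p => A p i j)
    (hu : ∀ j, Measurable fun p => u p j) (i : l) : Measurable fun p => (A p *ᵥ u p) i := by
  unfold Matrix.mulVec dotProduct
  exact Finset.measurable_fun_sum _ fun j _ => (hA i j).mul (hu j)

lemma measurable_pwKernel {α : Type*} [MeasurableSpace α] (η : ℝ) {z s : α → ℝ}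
    (hz : Measurable z) (hs : Measurable s) : Measurable fun p => pwKernel η (z p) (s p) := by
  unfold pwKernel
  refine Measurable.ite (measurableSet_eq_fun hz hs) measurable_const ?_
  fun_prop

lemma measurable_perturbedNorm_interpolant {η lam : ℝ} (hη : 0 < η) (hlam : 0 < lam)
    (w : Fin n → ℝ) (hd : d ≤ n) {f : ℝ → ℝ} (hf : Measurable f) (s : Fin d → ℤˣ) :
    Measurable fun p : Fin n → ℝ × ℝ =>
      perturbedNorm η lam w hd (fun k => (p k).1) (fun k => (p k).2) s
        (interpolant η f hd fun k => (p k).1) := by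
  have hx : ∀ k, Measurable fun p : Fin n → ℝ × ℝ => (p k).1 := fun k => by fun_prop
  have hK : ∀ i j, Measurable fun p : Fin n → ℝ × ℝ => gramBlock η hd (fun k => (p k).1) i j :=
    fun i j => measurable_pwKernel η (hx _) (hx _)
  have hB : ∀ i j, Measurable fun p : Fin n → ℝ × ℝ =>
      dataBlock η w hd (fun k => (p k).1) i j := fun i j => by
    simp only [dataBlock, Matrix.smul_apply, Matrix.diagonal_mul, smul_eq_mul]
    exact ((measurable_pwKernel η (hx _) (hx _)).const_mul _).const_mul _
  have hθ : ∀ j, Measurable fun p : Fin n → ℝ × ℝ => interpolant η f hd (fun k => (p k).1) j :=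
    measurable_mulVec_apply (measurable_matrix_inv_apply hK) fun j => hf.comp (hx _)
  have hr : ∀ k, Measurable fun p : Fin n → ℝ × ℝ =>
      signedResidual η w hd (fun k => (p k).1) (fun k => (p k).2) s
        (interpolant η f hd fun k => (p k).1) k := fun k => by
    refine Measurable.const_mul (Measurable.sub (by fun_prop) ?_) _
    exact measurable_mulVec_apply hB hθ k
  have hsum : ∀ j, Measurable fun p : Fin n → ℝ × ℝ =>
      perturbedSum η lam w hd (fun k => (p k).1) (fun k => (p k).2) s
        (interpolant η f hd fun k => (p k).1) j := fun j => by
    simp only [perturbedSum_eq hη hlam, Pi.smul_apply, Pi.sub_apply, smul_eq_mul]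
    refine Measurable.const_mul (Measurable.sub ?_ (Measurable.const_mul ?_ _)) _
    · exact measurable_mulVec_apply (fun i j => hB j i) hr j
    · exact measurable_mulVec_apply hK hθ j
  have hR : ∀ i j, Measurable fun p : Fin n → ℝ × ℝ =>
      shape η lam w hd (fun k => (p k).1) i j := fun i j => by
    simp only [shape, gram_regressor hη hlam, Matrix.smul_apply, Matrix.add_apply, smul_eq_mul,
      Matrix.mul_apply, Matrix.transpose_apply]
    refine Measurable.const_mul (Measurable.add ?_ ((hK i j).const_mul _)) _
    exact Finset.measurable_fun_sum _ fun k _ => (hB k i).mul (hB k j)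
  unfold perturbedNorm dotProduct
  exact Finset.measurable_fun_sum _ fun j _ => (hsum j).mul
    (measurable_mulVec_apply (measurable_matrix_inv_apply hR) hsum j)

end Algebra

/-! ### Ranks with tie breaking -/

/-- The number of entries of `z` that precede the entry `j`, when equal entries are ordered by the
permutation `π`. -/
def rankBelow {m : ℕ} (z : Fin m → ℝ) (π : Equiv.Perm (Fin m)) (j : Fin m) : ℕ :=
  (Finset.univ.filter fun i => z i < z j ∨ (z i = z j ∧ π i < π j)).card

lemma rankBelow_lt_rankBelow {m : ℕ} {z : Fin m → ℝ} {π : Equiv.Perm (Fin m)} {i j : Fin m}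
    (h : z i < z j ∨ (z i = z j ∧ π i < π j)) : rankBelow z π i < rankBelow z π j := by
  refine Finset.card_lt_card ⟨fun k hk => ?_, fun hsub => ?_⟩
  · simp only [Finset.mem_filter, Finset.mem_univ, true_and] at hk ⊢
    rcases h with h | ⟨h, h'⟩ <;> rcases hk with hk | ⟨hk, hk'⟩
    · exact Or.inl (hk.trans h)
    · exact Or.inl (hk ▸ h)
    · exact Or.inl (h ▸ hk)
    · exact Or.inr ⟨hk.trans h, hk'.trans h'⟩
  · have hi : i ∈ Finset.univ.filter fun k => z k < z j ∨ (z k = z j ∧ π k < π j) := by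
      simpa using h
    have := hsub hi
    simp at this

lemma rankBelow_injective {m : ℕ} (z : Fin m → ℝ) (π : Equiv.Perm (Fin m)) :
    Function.Injective (rankBelow z π) := by
  intro i j hij
  by_contra hne
  have hπ : π i ≠ π j := fun h => hne (π.injective h)
  rcases lt_trichotomy (z i) (z j) with h | h | h
  · exact (rankBelow_lt_rankBelow (π := π) (Or.inl h)).ne hij
  · rcases lt_or_gt_of_ne hπ with h' | h'
    · exact (rankBelow_lt_rankBelow (Or.inr ⟨h, h'⟩)).ne hij
    · exact (rankBelow_lt_rankBelow (Or.inr ⟨h.symm, h'⟩)).ne hij.symm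
  · exact (rankBelow_lt_rankBelow (π := π) (Or.inl h)).ne hij.symm

lemma rankBelow_lt {m : ℕ} (z : Fin m → ℝ) (π : Equiv.Perm (Fin m)) (j : Fin m) :
    rankBelow z π j < m := by
  conv_rhs => rw [← Fintype.card_fin m]
  refine Finset.card_lt_univ_of_notMem (x := j) ?_
  simp

/-- At most `q` entries have one of the `q` largest ranks. -/
lemma card_le_rankBelow_le {m q : ℕ} (hq : q ≤ m) (z : Fin m → ℝ) (π : Equiv.Perm (Fin m)) :
    (Finset.univ.filter fun j => m - q ≤ rankBelow z π j).card ≤ q := by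
  have h : (Finset.univ.filter fun j => m - q ≤ rankBelow z π j).card ≤
      (Finset.Ico (m - q) m).card := by
    refine Finset.card_le_card_of_injOn (rankBelow z π) (fun j hj => ?_)
      (rankBelow_injective z π).injOn
    simp only [Finset.coe_filter, Finset.mem_univ, true_and, Set.mem_ofPred_eq] at hj
    simpa using ⟨by omega, rankBelow_lt z π j⟩
  rw [Nat.card_Ico] at h
  omega

lemma rankBelow_comp {m : ℕ} (z : Fin m → ℝ) (π ρ : Equiv.Perm (Fin m)) (j : Fin m) :
    rankBelow (z ∘ ρ) (π * ρ) j = rankBelow z π (ρ j) :=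
  Finset.card_equiv ρ fun i => by
    rw [Finset.mem_filter, Finset.mem_filter]
    simp

lemma measurableSet_le_rankBelow {S : Type*} [MeasurableSpace S] {m : ℕ} {z : Fin m → S → ℝ}
    (hz : ∀ j, Measurable (z j)) (π : Equiv.Perm (Fin m)) (c : ℕ) (j : Fin m) :
    MeasurableSet {p | c ≤ rankBelow (fun i => z i p) π j} := by
  refine measurableSet_le measurable_const ?_
  simp only [rankBelow, Finset.card_filter]
  refine Finset.measurable_fun_sum _ fun i _ => Measurable.ite ?_ measurable_const measurable_const
  exact (measurableSet_lt (hz i) (hz j)).union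
    ((measurableSet_eq_fun (hz i) (hz j)).inter (MeasurableSet.const _))

/-! ### Sign-perturbed ranks are uniform -/

section Ranks

variable {S G : Type*} [MeasurableSpace S] [Fintype G] {Q : Measure S} [IsProbabilityMeasure Q]

/-- Averaged over all assignments of group elements and all tie-breaking permutations, each entry
is equally likely to have one of the `q` largest ranks. -/
lemma sum_measure_le_rankBelow_le {Z : G → S → ℝ} (hZ : ∀ s, Measurable (Z s)) {m q : ℕ}
    (hq : q ≤ m) (j₀ : Fin m) :
    m * ∑ u : Fin m → G, ∑ π : Equiv.Perm (Fin m),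
      Q.real {p | m - q ≤ rankBelow (fun i => Z (u i) p) π j₀} ≤
        q * (Fintype.card G ^ m * m.factorial : ℝ) := by
  have hms : ∀ (u : Fin m → G) (π : Equiv.Perm (Fin m)) (j : Fin m),
      MeasurableSet {p | m - q ≤ rankBelow (fun i => Z (u i) p) π j} := fun u π j =>
    measurableSet_le_rankBelow (fun i => hZ (u i)) π _ j
  -- for each assignment and sample at most `q` entries have one of the `q` largest ranks
  have hrow : ∀ (u : Fin m → G) (π : Equiv.Perm (Fin m)),
      ∑ j, Q.real {p | m - q ≤ rankBelow (fun i => Z (u i) p) π j} ≤ q := by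
    intro u π
    simp_rw [← fun j => integral_indicator_one (μ := Q) (hms u π j)]
    rw [← integral_finsetSum _ fun j _ =>
      (integrable_indicator_iff (hms u π j)).2 (integrable_const _).integrableOn]
    calc ∫ p, ∑ j, {p | m - q ≤ rankBelow (fun i => Z (u i) p) π j}.indicator 1 p ∂Q
        ≤ ∫ _p, (q : ℝ) ∂Q := by
          refine integral_mono (integrable_finsetSum _ fun j _ =>
            (integrable_indicator_iff (hms u π j)).2 (integrable_const _).integrableOn)
            (integrable_const _) fun p => ?_
          have h1 := card_le_rankBelow_le hq (fun i => Z (u i) p) π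
          simp only [Set.indicator_apply, Set.mem_ofPred_eq, Pi.one_apply, Finset.sum_boole]
          exact_mod_cast h1
      _ = q := by simp
  -- relabelling the entries by a transposition preserves the average
  have hswap : ∀ j, ∑ u : Fin m → G, ∑ π : Equiv.Perm (Fin m),
      Q.real {p | m - q ≤ rankBelow (fun i => Z (u i) p) π j} =
      ∑ u : Fin m → G, ∑ π : Equiv.Perm (Fin m),
      Q.real {p | m - q ≤ rankBelow (fun i => Z (u i) p) π j₀} := by
    intro j
    set ρ : Equiv.Perm (Fin m) := Equiv.swap j₀ j
    refine Fintype.sum_equiv (Equiv.arrowCongr ρ⁻¹ (Equiv.refl G)) _ _ fun u => ?_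
    refine Fintype.sum_equiv (Equiv.mulRight ρ) _ _ fun π => ?_
    congr 1 with p
    have h := rankBelow_comp (fun i => Z (u i) p) π ρ j₀
    rw [show ρ j₀ = j from Equiv.swap_apply_left _ _] at h
    simp only [Set.mem_ofPred_eq]
    rw [← h]
    rfl
  calc m * ∑ u : Fin m → G, ∑ π : Equiv.Perm (Fin m),
      Q.real {p | m - q ≤ rankBelow (fun i => Z (u i) p) π j₀}
      = ∑ j : Fin m, ∑ u : Fin m → G, ∑ π : Equiv.Perm (Fin m),
          Q.real {p | m - q ≤ rankBelow (fun i => Z (u i) p) π j} := by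
        rw [Finset.sum_congr rfl fun j _ => hswap j]
        simp
    _ = ∑ u : Fin m → G, ∑ π : Equiv.Perm (Fin m), ∑ j : Fin m,
          Q.real {p | m - q ≤ rankBelow (fun i => Z (u i) p) π j} := by
        rw [Finset.sum_comm]
        exact Finset.sum_congr rfl fun u _ => Finset.sum_comm
    _ ≤ ∑ _u : Fin m → G, ∑ _π : Equiv.Perm (Fin m), (q : ℝ) :=
        Finset.sum_le_sum fun u _ => Finset.sum_le_sum fun π _ => hrow u π
    _ = q * (Fintype.card G ^ m * m.factorial : ℝ) := by
        simp [Fintype.card_perm]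
        ring

/-- If translating the group argument of `Z` amounts to a measure preserving change of the sample,
then the identity may be taken as the distinguished group element. -/
lemma sum_measure_cons_one_le [Group G] {Z : G → S → ℝ} (hZ : ∀ s, Measurable (Z s)) {T : G → S → S}
    (hT : ∀ t, MeasurePreserving (T t) Q Q)
    (hZT : ∀ t, ∀ᵐ p ∂Q, ∀ s, Z s (T t p) = Z (s * t) p) {M q : ℕ} (hq : q ≤ M) :
    (M + 1) * ∑ σ : Fin M → G, ∑ π : Equiv.Perm (Fin (M + 1)),
      Q.real {p | M + 1 - q ≤ rankBelow
        (fun i => Z ((Fin.cons 1 σ : Fin (M + 1) → G) i) p) π 0} ≤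
        q * (Fintype.card G ^ M * (M + 1).factorial : ℝ) := by
  set b : (Fin (M + 1) → G) → ℝ := fun u => ∑ π : Equiv.Perm (Fin (M + 1)),
      Q.real {p | M + 1 - q ≤ rankBelow (fun i => Z (u i) p) π 0} with hb
  have hinv : ∀ u t, b (fun i => u i * t) = b u := by
    intro u t
    refine Finset.sum_congr rfl fun π _ => ?_
    have hms := measurableSet_le_rankBelow (fun i => hZ (u i)) π (M + 1 - q) 0
    rw [← (hT t).measureReal_preimage hms.nullMeasurableSet]
    refine measureReal_congr ?_
    filter_upwards [hZT t] with p hp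
    have : (fun i => Z (u i) (T t p)) = fun i => Z (u i * t) p := funext fun i => hp _
    change (M + 1 - q ≤ rankBelow (fun i => Z (u i * t) p) π 0) =
      (M + 1 - q ≤ rankBelow (fun i => Z (u i) (T t p)) π 0)
    rw [this]
  -- dividing by the group element of the distinguished entry makes it the identity
  have hsum : ∑ u, b u = Fintype.card G * ∑ σ : Fin M → G, b (Fin.cons 1 σ) := by
    rw [← (Fin.consEquiv fun _ => G).sum_comp, Fintype.sum_prod_type]
    have : ∀ t : G, ∑ σ : Fin M → G, b (Fin.consEquiv (fun _ => G) (t, σ)) =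
        ∑ σ : Fin M → G, b (Fin.cons 1 σ) := by
      intro t
      refine (Fintype.sum_equiv (Equiv.piCongrRight fun _ => Equiv.mulRight t) _ _ fun σ => ?_).symm
      rw [← hinv (Fin.cons 1 σ) t]
      congr 1
      funext i
      refine Fin.cases ?_ (fun i => ?_) i <;> simp [Fin.consEquiv]
    simp [this]
  have h := sum_measure_le_rankBelow_le (Q := Q) hZ (m := M + 1) (q := q) (by omega) 0
  change ((M + 1 : ℕ) : ℝ) * ∑ u, b u ≤ _ at h
  rw [hsum] at h
  have hG : (0 : ℝ) < Fintype.card G := by exact_mod_cast Fintype.card_pos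
  push_cast at h
  change (M + 1 : ℝ) * ∑ σ : Fin M → G, b (Fin.cons 1 σ) ≤ _
  refine le_of_mul_le_mul_left ?_ hG
  calc _ = ((M : ℝ) + 1) * (Fintype.card G * ∑ σ : Fin M → G, b (Fin.cons 1 σ)) := by ring
    _ ≤ _ := h
    _ = _ := by ring

end Ranks

/-! ### The law of the sample and of the seed -/

instance (M d : ℕ) : Fintype (Seed M d) :=
  inferInstanceAs (Fintype ((Fin M → Fin d → ℤˣ) × Equiv.Perm (Fin (M + 1))))

instance (M d : ℕ) : MeasurableSingletonClass (Seed M d) := ⟨fun _ => trivial⟩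

lemma card_seed (M d : ℕ) :
    Fintype.card (Seed M d) = Fintype.card (Fin d → ℤˣ) ^ M * (M + 1).factorial := by
  change Fintype.card ((Fin M → Fin d → ℤˣ) × Equiv.Perm (Fin (M + 1))) = _
  rw [Fintype.card_prod, Fintype.card_perm, Fintype.card_fin, Fintype.card_fun, Fintype.card_fin]

/-- The sample as a random vector of pairs. -/
def sampleMap {Ω : Type*} {n : ℕ} (X Y : Fin n → Ω → ℝ) (ω : Ω) : Fin n → ℝ × ℝ :=
  fun k => (X k ω, Y k ω)

lemma IIDSample.measurable_sampleMap {Ω : Type*} [MeasurableSpace Ω] {P : Measure Ω} {n : ℕ}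
    {X Y : Fin n → Ω → ℝ} (hS : IIDSample P X Y) :
    Measurable (sampleMap X Y) :=
  measurable_pi_lambda _ fun k => (hS.measurable_input k).prodMk (hS.measurable_output k)

section Sample

variable {Ω : Type*} [MeasurableSpace Ω] {P : Measure Ω} [IsProbabilityMeasure P]

lemma holdsWithProb_of_ae {S : Set Ω} (h : ∀ᵐ ω ∂P, ω ∈ S) : HoldsWithProb P (1 - 0) S := by
  refine ⟨(toMeasurable P Sᶜ)ᶜ, (measurableSet_toMeasurable _ _).compl,
    Set.compl_subset_comm.1 (subset_toMeasurable _ _), ?_⟩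
  rw [prob_compl_eq_one_sub (measurableSet_toMeasurable _ _), measure_toMeasurable]
  have : P Sᶜ = 0 := h
  simp [this]

lemma ae_input_ne {n : ℕ} {X Y : Fin n → Ω → ℝ} (hS : IIDSample P X Y) (hX : UniformInputs P X)
    {i j : Fin n} (hij : i ≠ j) : ∀ᵐ ω ∂P, X i ω ≠ X j ω := by
  have hind : IndepFun (X i) (X j) P :=
    (hS.indep.indepFun hij).comp measurable_fst measurable_fst
  have hlaw := (indepFun_iff_map_prod_eq_prod_map_map (hS.measurable_input i).aemeasurable
    (hS.measurable_input j).aemeasurable).1 hind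
  have hdiag : MeasurableSet {p : ℝ × ℝ | p.1 = p.2} :=
    measurableSet_eq_fun measurable_fst measurable_snd
  have hzero : P.map (fun ω => (X i ω, X j ω)) {p : ℝ × ℝ | p.1 = p.2} = 0 := by
    rw [hlaw, hX i, hX j, Measure.measure_prod_null hdiag]
    refine Filter.Eventually.of_forall fun x => ?_
    have : Prod.mk x ⁻¹' {p : ℝ × ℝ | p.1 = p.2} = {x} := by
      ext y
      simp [eq_comm]
    simp only [this, Pi.zero_apply]
    exact measure_singleton x
  rw [Measure.map_apply ((hS.measurable_input i).prodMk (hS.measurable_input j)) hdiag] at hzero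
  rw [ae_iff]
  simpa using hzero

lemma ae_injective_inputs {n d : ℕ} (hd : d ≤ n) {X Y : Fin n → Ω → ℝ} (hS : IIDSample P X Y)
    (hX : UniformInputs P X) :
    ∀ᵐ ω ∂P, Function.Injective fun k : Fin d => X (Fin.castLE hd k) ω := by
  have h : ∀ᵐ ω ∂P, ∀ i j : Fin n, i ≠ j → X i ω ≠ X j ω :=
    ae_all_iff.2 fun i => ae_all_iff.2 fun j => by
      by_cases hij : i = j
      · simp [hij]
      · filter_upwards [ae_input_ne hS hX hij] with ω hω _ using hω
  filter_upwards [h] with ω hω i j hij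
  by_contra hne
  exact hω _ _ (fun h' => hne (Fin.castLE_injective hd h')) hij

/-- The change of the sample that flips the noises at the first `d` inputs. -/
def flipSample {n d : ℕ} (f : ℝ → ℝ) (t : Fin d → ℤˣ) (p : Fin n → ℝ × ℝ) : Fin n → ℝ × ℝ :=
  fun k => ((p k).1, flipOutput f t (fun i => (p i).1) (fun i => (p i).2) k)

/-- The law of a sample with symmetric noises is invariant under flipping noises. -/
lemma measurePreserving_flipSample {n d : ℕ} {X Y : Fin n → Ω → ℝ} (hS : IIDSample P X Y)
    {f : ℝ → ℝ} (hf : Measurable f) (hsym : SymmetricNoise P f X Y) (t : Fin d → ℤˣ) :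
    MeasurePreserving (flipSample f t) (P.map (sampleMap X Y)) (P.map (sampleMap X Y)) := by
  have hm : ∀ k, Measurable fun ω => (X k ω, Y k ω) := fun k =>
    (hS.measurable_input k).prodMk (hS.measurable_output k)
  have hlaw : P.map (sampleMap X Y) = Measure.pi fun k => P.map fun ω => (X k ω, Y k ω) :=
    (iIndepFun_iff_map_fun_eq_pi_map fun k => (hm k).aemeasurable).1 hS.indep
  have hprob : ∀ k, IsProbabilityMeasure (P.map fun ω => (X k ω, Y k ω)) := fun k =>
    Measure.isProbabilityMeasure_map (hm k).aemeasurable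
  rw [hlaw]
  refine measurePreserving_pi (f := fun (k : Fin n) (p : ℝ × ℝ) => (p.1, f p.1 +
    (if h : (k : ℕ) < d then (((t ⟨k, h⟩ : ℤˣ) : ℤ) : ℝ) else 1) * (p.2 - f p.1)))
    _ _ fun k => ?_
  have hone : MeasurePreserving (fun p : ℝ × ℝ => (p.1, f p.1 + 1 * (p.2 - f p.1)))
      (P.map fun ω => (X k ω, Y k ω)) (P.map fun ω => (X k ω, Y k ω)) := by
    have : (fun p : ℝ × ℝ => (p.1, f p.1 + 1 * (p.2 - f p.1))) = id := by
      funext p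
      simp
    rw [this]
    exact MeasurePreserving.id _
  -- the reflection of the noise, in the coordinates input and output
  have hneg : MeasurePreserving (fun p : ℝ × ℝ => (p.1, f p.1 + (-1) * (p.2 - f p.1)))
      (P.map fun ω => (X k ω, Y k ω)) (P.map fun ω => (X k ω, Y k ω)) := by
    have hflip : Measurable fun p : ℝ × ℝ => (p.1, f p.1 + (-1) * (p.2 - f p.1)) := by fun_prop
    refine ⟨hflip, ?_⟩
    have hshift : Measurable fun p : ℝ × ℝ => (p.1, f p.1 + p.2) := by fun_prop
    have h := ((hsym k).comp hshift).map_eq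
    rw [Measure.map_map hflip (hm k)]
    calc _ = P.map ((fun p : ℝ × ℝ => (p.1, f p.1 + p.2)) ∘
          fun ω => (X k ω, -(Y k ω - f (X k ω)))) := by
          congr 1
          funext ω
          simp
      _ = _ := h.symm
      _ = _ := by
          congr 1
          funext ω
          simp
  by_cases hk : (k : ℕ) < d
  · rcases Int.units_eq_one_or (t ⟨k, hk⟩) with h | h
    · simpa only [dif_pos hk, h, Units.val_one, Int.cast_one] using hone
    · simpa only [dif_pos hk, h, Units.val_neg, Units.val_one, Int.cast_neg, Int.cast_one]
        using hneg
  · simpa only [dif_neg hk] using hone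

/-- The rank condition that defines the region, with the unperturbed entry counted among all
`M + 1` entries: it does not precede itself. -/
lemma mem_kgpRegion_of_rankBelow_lt {n d : ℕ} {η lam : ℝ} {w : Fin n → ℝ} {hd : d ≤ n}
    {x y : Fin n → ℝ} {M q : ℕ} {a : Seed M d} {θ : Fin d → ℝ}
    (h : rankBelow (fun i => perturbedNorm η lam w hd x y
      ((Fin.cons 1 a.1 : Fin (M + 1) → Fin d → ℤˣ) i) θ) a.2 0 < M + 1 - q) :
    θ ∈ kgpRegion η lam w hd x y q a := by
  rw [kgpRegion, Set.mem_ofPred_eq]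
  rw [rankBelow, Fin.card_filter_univ_succ] at h
  simp only [lt_irrefl, and_false, or_false, if_false, Fin.cons_zero] at h
  rw [Set.ncard_eq_toFinset_card', Set.toFinset_ofPred]
  have h2 : (Finset.univ.filter ((fun i : Fin (M + 1) => perturbedNorm η lam w hd x y
      ((Fin.cons 1 a.1 : Fin (M + 1) → Fin d → ℤˣ) i) θ < perturbedNorm η lam w hd x y 1 θ ∨
      (perturbedNorm η lam w hd x y ((Fin.cons 1 a.1 : Fin (M + 1) → Fin d → ℤˣ) i) θ =
        perturbedNorm η lam w hd x y 1 θ ∧ a.2 i < a.2 0)) ∘ Fin.succ)).card < M + 1 - q := h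
  simp only [Function.comp_def, Fin.cons_succ] at h2
  omega

/-- The interpolant belongs to the exact confidence region with probability at least
`1 - q / (M + 1)`. -/
lemma holdsWithProb_rankBelow_lt {n d : ℕ} {η lam β : ℝ} (hη : 0 < η) (hlam : 0 < lam)
    (w : Fin n → ℝ) (hd : d ≤ n) {X Y : Fin n → Ω → ℝ} (hS : IIDSample P X Y)
    (hX : UniformInputs P X) {f : ℝ → ℝ} (hf : Measurable f) (hsym : SymmetricNoise P f X Y)
    {M q : ℕ} (hq : q ≤ M) (hβ : (q : ℝ) / (M + 1) ≤ β) {A : Ω → Seed M d}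
    (hA : RandomSeed P X Y A) :
    HoldsWithProb P (1 - β) {ω | interpolant η f hd (fun i => X i ω) ∈
      kgpRegion η lam w hd (fun i => X i ω) (fun i => Y i ω) q (A ω)} := by
  set V := sampleMap X Y with hV
  have hVm : Measurable V := hS.measurable_sampleMap
  set Q := P.map V with hQ
  have hQp : IsProbabilityMeasure Q := Measure.isProbabilityMeasure_map hVm.aemeasurable
  set Z : (Fin d → ℤˣ) → (Fin n → ℝ × ℝ) → ℝ := fun s p =>
    perturbedNorm η lam w hd (fun k => (p k).1) (fun k => (p k).2) s
      (interpolant η f hd fun k => (p k).1) with hZ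
  have hZm : ∀ s, Measurable (Z s) := measurable_perturbedNorm_interpolant hη hlam w hd hf
  have hinj : ∀ᵐ p ∂Q, Function.Injective fun k : Fin d => (p (Fin.castLE hd k)).1 := by
    rw [hQ, ae_map_iff hVm.aemeasurable]
    · exact ae_injective_inputs hd hS hX
    · simp only [Function.Injective, Set.ofPred_forall]
      refine MeasurableSet.iInter fun i => MeasurableSet.iInter fun j => ?_
      refine MeasurableSet.imp (measurableSet_eq_fun ?_ ?_) (MeasurableSet.const _) <;> fun_prop
  have hZT : ∀ t : Fin d → ℤˣ, ∀ᵐ p ∂Q, ∀ s, Z s (flipSample f t p) = Z (s * t) p := by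
    intro t
    filter_upwards [hinj] with p hp s
    exact perturbedNorm_flipOutput hη hlam w hd hp _ f s t
  have hcount := sum_measure_cons_one_le hZm (measurePreserving_flipSample hS hf hsym) hZT hq
  set B : Seed M d → Set (Fin n → ℝ × ℝ) := fun a => {p | M + 1 - q ≤ rankBelow
    (fun i => Z ((Fin.cons 1 a.1 : Fin (M + 1) → Fin d → ℤˣ) i) p) a.2 0} with hB
  have hBm : ∀ a, MeasurableSet (B a) := fun a =>
    measurableSet_le_rankBelow (fun i => hZm _) _ _ _
  set bad : Set Ω := ⋃ a, V ⁻¹' B a ∩ A ⁻¹' {a} with hbad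
  have hbadm : MeasurableSet bad := MeasurableSet.iUnion fun a =>
    (hVm (hBm a)).inter (hA.measurable (measurableSet_singleton a))
  have hcard : (0 : ℝ) < Fintype.card (Seed M d) := by
    rw [card_seed]
    have : 0 < Fintype.card (Fin d → ℤˣ) := Fintype.card_pos
    positivity
  have hAa : ∀ a, P.real (A ⁻¹' {a}) = 1 / Fintype.card (Seed M d) := by
    intro a
    rw [measureReal_def, ← Measure.map_apply hA.measurable (measurableSet_singleton a),
      hA.uniform, uniformOn_univ, Measure.count_singleton]
    simp
  have hpiece : ∀ a, P.real (V ⁻¹' B a ∩ A ⁻¹' {a}) =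
      Q.real (B a) / Fintype.card (Seed M d) := by
    intro a
    have h := hA.indep.measure_inter_preimage_eq_mul (B a) {a} (hBm a)
      (measurableSet_singleton a)
    rw [measureReal_def, show P (V ⁻¹' B a ∩ A ⁻¹' {a}) = _ from h, ENNReal.toReal_mul,
      ← measureReal_def, ← measureReal_def, hAa, map_measureReal_apply hVm (hBm a), mul_one_div]
    rfl
  have hbadP : P.real bad ≤ β := by
    have hsum : ∑ a, Q.real (B a) = ∑ σ : Fin M → Fin d → ℤˣ,
        ∑ π : Equiv.Perm (Fin (M + 1)), Q.real {p | M + 1 - q ≤ rankBelow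
        (fun i => Z ((Fin.cons 1 σ : Fin (M + 1) → Fin d → ℤˣ) i) p) π 0} :=
      Fintype.sum_prod_type (fun a : (Fin M → Fin d → ℤˣ) × Equiv.Perm (Fin (M + 1)) =>
        Q.real (B a))
    have hM : (0 : ℝ) < M + 1 := by positivity
    calc P.real bad ≤ ∑ a, P.real (V ⁻¹' B a ∩ A ⁻¹' {a}) := measureReal_iUnion_fintype_le _
      _ = (∑ a, Q.real (B a)) / Fintype.card (Seed M d) := by
          simp_rw [hpiece, Finset.sum_div]
      _ ≤ q / (M + 1) := by
          rw [div_le_div_iff₀ hcard hM, mul_comm, hsum, card_seed]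
          push_cast
          exact hcount
      _ ≤ β := hβ
  refine ⟨badᶜ, hbadm.compl, fun ω hω => ?_, ?_⟩
  · refine mem_kgpRegion_of_rankBelow_lt (not_le.1 fun hle => hω ?_)
    exact Set.mem_iUnion.2 ⟨A ω, hle, rfl⟩
  · rw [← ofReal_measureReal, measureReal_compl hbadm, probReal_univ]
    exact ENNReal.ofReal_le_ofReal (by linarith)

/-- The kernel gradient perturbation intervals are simultaneous confidence intervals. -/
lemma holdsWithProb_kgp_covers {n d : ℕ} {η lam β : ℝ} (hη : 0 < η) (hlam : 0 < lam)
    (w : Fin n → ℝ) (hd1 : 1 ≤ d) (hd : d ≤ n) {X Y : Fin n → Ω → ℝ} (hS : IIDSample P X Y)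
    (hX : UniformInputs P X) {f : ℝ → ℝ} (hf : Measurable f) (hsym : SymmetricNoise P f X Y)
    {M q : ℕ} (hq : q ≤ M) (hβ : (q : ℝ) / (M + 1) ≤ β) {A : Ω → Seed M d}
    (hA : RandomSeed P X Y A) :
    HoldsWithProb P (1 - β) {ω | ∀ k : Fin d,
      kgpLower η lam w hd (fun i => X i ω) (fun i => Y i ω) q (A ω) k
        ≤ (f (X (Fin.castLE hd k) ω) : EReal) ∧
      (f (X (Fin.castLE hd k) ω) : EReal)
        ≤ kgpUpper η lam w hd (fun i => X i ω) (fun i => Y i ω) q (A ω) k} := by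
  have h := (holdsWithProb_of_ae (ae_injective_inputs hd hS hX)).inter
    (holdsWithProb_rankBelow_lt hη hlam w hd hS hX hf hsym hq hβ hA)
    fun ω hω k => kgp_covers hη hlam w hd1 hd (x := fun i => X i ω) hω.1 (fun i => Y i ω) hq
      (A ω) f hω.2 k
  rwa [sub_zero] at h

end Sample

end PWBand

end

theorem theorem2 {Ω : Type*} [MeasurableSpace Ω] (P : MeasureTheory.Measure Ω)
    [MeasureTheory.IsProbabilityMeasure P]
    (η δ₀ : ℝ) (hη : 0 < η) (hδ₀ : 0 < δ₀)
    (f : ℝ → ℝ) (n d : ℕ) (hd1 : 1 ≤ d) (hd : d ≤ n) (X Y : Fin n → Ω → ℝ)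
    (hA0 : PWBand.IIDSample P X Y)
    (hA2 : PWBand.UniformInputs P X)
    (hA3 : PWBand.RegularTarget η δ₀ f)
    (α β : ℝ) (hα : α ∈ Set.Ioo (0 : ℝ) 1) (hβ : β ∈ Set.Ioo (0 : ℝ) 1) :
    -- any simultaneous confidence intervals at the first `d` inputs give a confidence band
    (∀ ν μ : Ω → Fin d → EReal,
      PWBand.HoldsWithProb P (1 - β) {ω | ∀ k : Fin d,
        ν ω k ≤ (f (X (Fin.castLE hd k) ω) : EReal) ∧
        (f (X (Fin.castLE hd k) ω) : EReal) ≤ μ ω k} →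
      PWBand.HoldsWithProb P (1 - α - β) {ω | PWBand.graphOnUnit f ⊆
        PWBand.bandRegion η α δ₀ (fun k => X (Fin.castLE hd k) ω) (ν ω) (μ ω)}) ∧
    -- the kernel gradient perturbation intervals are such intervals, and give such a band
    (PWBand.SymmetricNoise P f X Y →
      ∀ (lam : ℝ) (w : Fin n → ℝ) (M q : ℕ) (A : Ω → PWBand.Seed M d),
        0 < lam → (∀ k, 0 < w k) → 0 < q → q ≤ M → (q : ℝ) / (M + 1) ≤ β →
        PWBand.RandomSeed P X Y A →
        PWBand.HoldsWithProb P (1 - β) {ω | ∀ k : Fin d,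
          PWBand.kgpLower η lam w hd (fun i => X i ω) (fun i => Y i ω) q (A ω) k
            ≤ (f (X (Fin.castLE hd k) ω) : EReal) ∧
          (f (X (Fin.castLE hd k) ω) : EReal)
            ≤ PWBand.kgpUpper η lam w hd (fun i => X i ω) (fun i => Y i ω) q (A ω) k} ∧
        PWBand.HoldsWithProb P (1 - α - β) {ω | PWBand.graphOnUnit f ⊆
          PWBand.bandRegion η α δ₀ (fun k => X (Fin.castLE hd k) ω)
            (PWBand.kgpLower η lam w hd (fun i => X i ω) (fun i => Y i ω) q (A ω))
            (PWBand.kgpUpper η lam w hd (fun i => X i ω) (fun i => Y i ω) q (A ω))}) := by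
  have hband := fun ν μ => PWBand.holdsWithProb_graph_subset_band (β := β) hη hα hA3 hd1 hd hA0 hA2
    ν μ
  refine ⟨hband, fun hsym lam w M q A hlam _ _ hq hqβ hA => ?_⟩
  have hcov := PWBand.holdsWithProb_kgp_covers hη hlam w hd1 hd hA0 hA2 hA3.mem.1.measurable hsym
    hq hqβ hA
  exact ⟨hcov, hband _ _ hcov⟩
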